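/- Let $n\ge 1$ and let $q,p_1,\dots,p_{n-1}$ be positive integers with $p_i<q$ and $\gcd(p_i,q)=1$ for all $i$. Let $C=C(q;p_1,\dots,p_{n-1})=\operatorname{Cone}(v_1,\dots,v_n)$ be the simplicial cone in $V=\mathbb R^n$ with ordered generators $v_i=e_i$ for $1\le i\le n-1$ and $v_n=(p_1,\dots,p_{n-1},q)$, and let $B=\{v_1,\dots,v_n\}$. Let $M_C$ be the matrix with columns $v_1,\dots,v_n$ (so $\det M_C=q$), let $\Gamma_C=\mathbb Z^n/\sum_i\mathbb Z v_i$, and let $\chi_j(\gamma)=e^{2\pi i a_j}$ if $\gamma$ is the class of $\sum_j a_jv_j\in\mathbb Z^n$. For $N\ge 0$ let $\operatorname{Todd}_C^N(x_1,\dots,x_n)$ be the homogeneous part of total degree $N$ of the Taylor series at $0$ of $$\operatorname{Todd}_C(x_1,\dots,x_n)=\sum_{\gamma\in\Gamma_C}\prod_{j=1}^n\frac{x_j}{1-\chi_j(\gamma)e^{-x_j}}.$$ Let $S^N(C)$ be the rational function on $V$ $$S^N(C)=\frac{\operatorname{Todd}_C^N(v_1^*,\dots,v_n^*)}{(\det M_C)\,v_1^*\cdots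 v_n^*},$$ where $v_1^*,\dots,v_n^*$ is the basis of $V^*$ dual to $v_1,\dots,v_n$, and let $S^N(C)_B$ be this function written in the coordinates $x_1,\dots,x_n$ with respect to $B$. Finally let $d_{N,n}$ be the least common multiple of the denominators of the coefficients of the homogeneous part of total degree $N$ of $\prod_{i=1}^n \frac{x_i}{1-e^{-x_i}}$. Then for every integer $N\ge 0$ $$\operatorname{Todd}_C^N(x_1,\dots,x_n)=q\,x_1\cdots x_n\,S^N(C)_B\;\in\;\frac1{d_{N,n}}\,\mathbb Z[x_1,\dots,x_n].$$ -/

import Mathlib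

noncomputable section

namespace ToddCone

/-! ### The one-variable series -/

section OneVariable

variable {K : Type*} [Field K] [Algebra ℚ K]

/-- The power series `1 - c * exp (-X)`. -/
def oneSubMulExpNeg (c : K) : PowerSeries K :=
  1 - PowerSeries.C c * PowerSeries.evalNegHom (PowerSeries.exp K)

open Classical in
/-- The Taylor series at `0` of `x / (1 - c * exp (-x))`.  For `c ≠ 1` the denominator is
invertible as a power series; for `c = 1` it is `x` times an invertible power series, and the
common factor `x` is cancelled.  See `toddFactor_mul` for the characterizing identity. -/
def toddFactor (c : K) : PowerSeries K :=
  if c = 1 then (PowerSeries.mk fun k => PowerSeries.coeff (k + 1) (oneSubMulExpNeg c))⁻¹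
  else PowerSeries.X * (oneSubMulExpNeg c)⁻¹

theorem toddFactor_mul (c : K) : toddFactor c * oneSubMulExpNeg c = PowerSeries.X := by
  have h0 : PowerSeries.constantCoeff (oneSubMulExpNeg c) = 1 - c := by
    simp [oneSubMulExpNeg, PowerSeries.evalNegHom, ← PowerSeries.coeff_zero_eq_constantCoeff_apply,
      PowerSeries.coeff_rescale, -PowerSeries.coeff_zero_eq_constantCoeff]
  unfold toddFactor
  split_ifs with hc
  · have h1 : PowerSeries.constantCoeff
        (PowerSeries.mk fun k => PowerSeries.coeff (k + 1) (oneSubMulExpNeg c)) ≠ 0 := by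
      subst hc
      simp [oneSubMulExpNeg, PowerSeries.evalNegHom, PowerSeries.coeff_rescale,
        PowerSeries.coeff_exp, ← PowerSeries.coeff_zero_eq_constantCoeff_apply,
        PowerSeries.coeff_one]
    have h2 := PowerSeries.eq_X_mul_shift_add_const (oneSubMulExpNeg c)
    rw [h0, hc, sub_self, map_zero, add_zero] at h2
    rw [hc] at h1
    rw [hc]
    generalize oneSubMulExpNeg (1 : K) = f at h1 h2
    generalize (PowerSeries.mk fun k => PowerSeries.coeff (k + 1) f) = g at h1 h2
    rw [h2, mul_left_comm, PowerSeries.inv_mul_cancel _ h1, mul_one]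
  · rw [mul_assoc, PowerSeries.inv_mul_cancel, mul_one]
    rw [h0]
    exact sub_ne_zero.mpr (Ne.symm hc)

end OneVariable

/-! ### Homogeneous parts and the constants `d_{N,n}` -/

/-- The homogeneous part of total degree `N` of a power series in `n` variables, as a polynomial. -/
def homogPart {K : Type*} [CommSemiring K] {n : ℕ} (f : MvPowerSeries (Fin n) K) (N : ℕ) :
    MvPolynomial (Fin n) K :=
  ∑ r ∈ Finset.finsuppAntidiag Finset.univ N, MvPolynomial.monomial r (MvPowerSeries.coeff r f)

/-- The Todd power series in `n` variables `∏ i, x_i / (1 - exp (-x_i))`. -/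
def stdTodd (n : ℕ) : MvPowerSeries (Fin n) ℚ :=
  ∏ i : Fin n, PowerSeries.subst (MvPowerSeries.X i : MvPowerSeries (Fin n) ℚ) (toddFactor (1 : ℚ))

/-- `d_{N,n}`: the least common multiple of the denominators of the coefficients of the
`N`-th Todd polynomial in `n` variables. -/
def toddDenom (N n : ℕ) : ℕ :=
  (homogPart (stdTodd n) N).support.lcm fun r =>
    (MvPolynomial.coeff r (homogPart (stdTodd n) N)).den

/-! ### Cones -/

/-- A nondegenerate `n`-simplicial cone in `ℝⁿ`: an ordered `n`-tuple of linearly independent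
vectors of `ℤⁿ`. -/
structure SimplicialCone (n : ℕ) where
  /-- The ordered generators `v_1, …, v_n`. -/
  gen : Fin n → Fin n → ℤ
  det_ne_zero : (Matrix.of fun k i => gen i k).det ≠ 0

namespace SimplicialCone

variable {n : ℕ} (C : SimplicialCone n)

/-- The matrix `M_C` whose columns are the generators. -/
def M : Matrix (Fin n) (Fin n) ℤ := Matrix.of fun k i => C.gen i k

/-- The matrix `M_C` with complex entries. -/
def MC : Matrix (Fin n) (Fin n) ℂ := C.M.map (Int.cast : ℤ → ℂ)

theorem det_MC : C.MC.det = (C.M.det : ℂ) :=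
  (Int.cast_det (R := ℂ) C.M).symm

theorem det_MC_ne_zero : C.MC.det ≠ 0 := by
  rw [det_MC]
  exact_mod_cast C.det_ne_zero

/-- The sublattice `Λ_C` of `ℤⁿ` spanned by the generators. -/
def lattice : Submodule ℤ (Fin n → ℤ) := Submodule.span ℤ (Set.range C.gen)

/-- The quotient group `Γ_C = ℤⁿ / Λ_C`. -/
abbrev Gamma : Type := (Fin n → ℤ) ⧸ C.lattice

/-- The `j`-th coordinate `a_j` of `v = ∑ j, a_j v_j` with respect to the generators. -/
def coord (j : Fin n) : (Fin n → ℤ) →ₗ[ℤ] ℂ where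
  toFun v := C.MC⁻¹.mulVec (fun k => (v k : ℂ)) j
  map_add' u v := by
    have : (fun k => (((u + v) k : ℤ) : ℂ)) = (fun k => (u k : ℂ)) + fun k => (v k : ℂ) := by
      ext k; simp
    rw [this, Matrix.mulVec_add, Pi.add_apply]
  map_smul' a v := by
    have : (fun k => (((a • v) k : ℤ) : ℂ)) = (a : ℂ) • fun k => (v k : ℂ) := by
      ext k; simp
    rw [this, Matrix.mulVec_smul]
    simp

theorem coord_gen (i j : Fin n) : C.coord j (C.gen i) = if j = i then 1 else 0 := by
  have h : C.MC⁻¹ * C.MC = 1 :=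
    Matrix.nonsing_inv_mul _ (isUnit_iff_ne_zero.mpr C.det_MC_ne_zero)
  have h2 := congrFun (congrFun h j) i
  rw [Matrix.one_apply, Matrix.mul_apply] at h2
  rw [← h2]
  rfl

theorem coord_mem {v : Fin n → ℤ} (hv : v ∈ C.lattice) (j : Fin n) :
    ∃ a : ℤ, C.coord j v = a := by
  induction hv using Submodule.span_induction with
  | mem x hx =>
    obtain ⟨i, rfl⟩ := hx
    refine ⟨if j = i then 1 else 0, ?_⟩
    rw [coord_gen]
    split_ifs <;> simp
  | zero => exact ⟨0, by simp⟩
  | add x y _ _ hx hy =>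
    obtain ⟨a, ha⟩ := hx
    obtain ⟨b, hb⟩ := hy
    exact ⟨a + b, by simp [ha, hb]⟩
  | smul c x _ hx =>
    obtain ⟨a, ha⟩ := hx
    exact ⟨c * a, by rw [map_smul, ha]; simp⟩

/-- The character `χ_j` on `Γ_C`: the class of `v = ∑ j, a_j v_j` is sent to `exp (2πi a_j)`. -/
def char (j : Fin n) : C.Gamma → ℂ :=
  Quotient.lift (fun v : Fin n → ℤ => Complex.exp (2 * Real.pi * Complex.I * C.coord j v)) <| by
    intro u v huv
    have huv' : u - v ∈ C.lattice := (Submodule.quotientRel_def C.lattice).mp huv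
    obtain ⟨a, ha⟩ := C.coord_mem huv' j
    rw [map_sub, sub_eq_iff_eq_add] at ha
    refine Complex.exp_eq_exp_iff_exists_int.mpr ⟨a, ?_⟩
    rw [ha]
    ring

theorem linearIndependent_gen : LinearIndependent ℤ C.gen := by
  have h : (Matrix.of fun i k => C.gen i k).det ≠ 0 := by
    rw [← Matrix.det_transpose]
    exact C.det_ne_zero
  exact Matrix.linearIndependent_rows_of_det_ne_zero h

instance finite_Gamma : Finite C.Gamma := by
  apply Submodule.finiteQuotientOfFreeOfRankEq
  rw [lattice, finrank_span_eq_card C.linearIndependent_gen]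
  simp

instance fintype_Gamma : Fintype C.Gamma := Fintype.ofFinite _

/-- The Taylor series at `0` of the Todd series
`Todd_C(x_1, …, x_n) = ∑ γ ∈ Γ_C, ∏ i, x_i / (1 - χ_i(γ) exp (-x_i))`. -/
def todd : MvPowerSeries (Fin n) ℂ :=
  ∑ γ : C.Gamma, ∏ i : Fin n,
    PowerSeries.subst (MvPowerSeries.X i : MvPowerSeries (Fin n) ℂ) (toddFactor (C.char i γ))

/-- The `N`-th Todd polynomial `Todd_C^N` of `C`. -/
def toddPoly (N : ℕ) : MvPolynomial (Fin n) ℂ := homogPart C.todd N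

/-! ### Rational functions on `V`

Polynomial and rational functions on `V = ℝⁿ` are written in the coordinates `y_1, …, y_n` with
respect to the standard basis; the variables `X k` below are these `y_k`. -/

/-- The linear function `v_i^*` on `V`, the `i`-th element of the basis dual to the generators. -/
def dualGen (i : Fin n) : MvPolynomial (Fin n) ℂ :=
  ∑ k, MvPolynomial.C (C.MC⁻¹ i k) * MvPolynomial.X k

/-- The polynomial function `T^N(C) = Todd_C^N(v_1^*, …, v_n^*)` on `V`. -/
def T (N : ℕ) : MvPolynomial (Fin n) ℂ := MvPolynomial.aeval C.dualGen (C.toddPoly N)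

/-- The rational function `S^N(C) = T^N(C) / (det M_C · v_1^* ⋯ v_n^*)` on `V`. -/
def S (N : ℕ) : FractionRing (MvPolynomial (Fin n) ℂ) :=
  algebraMap _ _ (C.T N) /
    algebraMap _ _ (MvPolynomial.C (C.M.det : ℂ) * ∏ i, C.dualGen i)

/-- A polynomial function on `V` rewritten in the coordinates `x_1, …, x_n` with respect to the
ordered basis `B = {v_1, …, v_n}` of generators of `C`: substitute `y = ∑ i, x_i v_i`. -/
def polyInBasis : MvPolynomial (Fin n) ℂ →ₐ[ℂ] MvPolynomial (Fin n) ℂ :=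
  MvPolynomial.aeval fun k => ∑ i, MvPolynomial.C ((C.gen i k : ℤ) : ℂ) * MvPolynomial.X i

theorem polyInBasis_injective : Function.Injective C.polyInBasis := by
  have h : C.MC * C.MC⁻¹ = 1 :=
    Matrix.mul_nonsing_inv _ (isUnit_iff_ne_zero.mpr C.det_MC_ne_zero)
  have key : (MvPolynomial.aeval C.dualGen).comp C.polyInBasis = AlgHom.id ℂ _ := by
    apply MvPolynomial.algHom_ext
    intro k
    have h2 : ∀ l, ∑ i, ((C.gen i k : ℤ) : ℂ) * C.MC⁻¹ i l = if k = l then 1 else 0 := by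
      intro l
      have := congrFun (congrFun h k) l
      rw [Matrix.one_apply, Matrix.mul_apply] at this
      rw [← this]
      rfl
    simp only [AlgHom.comp_apply, polyInBasis, MvPolynomial.aeval_X, map_sum, map_mul,
      MvPolynomial.aeval_C, MvPolynomial.algebraMap_eq, dualGen, Finset.mul_sum, AlgHom.id_apply]
    rw [Finset.sum_comm]
    simp only [← mul_assoc, ← map_mul, ← Finset.sum_mul, ← map_sum, h2]
    simp
  intro f g hfg
  have h3 : ∀ f, MvPolynomial.aeval C.dualGen (C.polyInBasis f) = f := fun f =>
    DFunLike.congr_fun key f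
  rw [← h3 f, hfg, h3 g]

/-- A rational function `f` on `V` rewritten in the coordinates `x_1, …, x_n` with respect to the
ordered basis `B = {v_1, …, v_n}` of generators of `C`; this is `f_B`. -/
def inBasis : FractionRing (MvPolynomial (Fin n) ℂ) →+* FractionRing (MvPolynomial (Fin n) ℂ) :=
  IsFractionRing.map (A := MvPolynomial (Fin n) ℂ) (B := MvPolynomial (Fin n) ℂ)
    (j := C.polyInBasis.toRingHom) C.polyInBasis_injective

end SimplicialCone

/-! ### The cone `C(q; p_1, …, p_{n-1})` with `n = m + 1` -/

/-- The generators `v_i = e_i` for `i < n` and `v_n = (p_1, …, p_{n-1}, q)`, with `n = m + 1`. -/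
def dedekindGen {m : ℕ} (q : ℕ) (p : Fin m → ℕ) : Fin (m + 1) → Fin (m + 1) → ℤ :=
  Fin.snoc (α := fun _ => Fin (m + 1) → ℤ) (fun i : Fin m => Pi.single i.castSucc 1)
    (Fin.snoc (α := fun _ => ℤ) (fun i => (p i : ℤ)) (q : ℤ))

theorem det_dedekindGen {m : ℕ} (q : ℕ) (p : Fin m → ℕ) :
    (Matrix.of fun k i => dedekindGen q p i k).det = (q : ℤ) := by
  rw [Matrix.det_of_isUpperTriangular, Fin.prod_univ_castSucc]
  · simp [dedekindGen]
  · intro k i hik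
    simp only [id] at hik
    induction i using Fin.lastCases with
    | last => exact absurd (Fin.le_last k) (not_le.mpr hik)
    | cast i => simp [dedekindGen, hik.ne']

/-- The cone `C(q; p_1, …, p_{n-1})`, with `n = m + 1`. -/
def dedekindCone {m : ℕ} (q : ℕ) (hq : 0 < q) (p : Fin m → ℕ) : SimplicialCone (m + 1) where
  gen := dedekindGen q p
  det_ne_zero := by
    rw [det_dedekindGen]
    exact_mod_cast hq.ne'

end ToddCone

end

/-!
# Todd polynomials of simplicial cones

The dual of a simplicial cone is, modulo functions with a period, a sum of duals of unimodular
cones. Comparing generating functions of lattice points expresses the Todd polynomial of the cone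
through those of unimodular cones, and Gauss's lemma bounds its denominators.
-/

noncomputable section

open Matrix

namespace ToddCone

/-! ### Dual cones and their unimodular decomposition -/

section Decomposition

variable {n : ℕ}

/-! The integrality holds for every simplicial cone with generators `v_i`; put D = |det M_C|. Let σ
be the generating function of the lattice points of the dual cone {m | v_i·m ≥ 0 for all i}, with m
weighted by exp(-(m·y)t), y = ∑ x_i v_i. Orthogonality of characters on Γ_C turns the sum of the
products ∏ 1/(1 - χ_j(γ) exp(-x_j t)) into D·σ (`sum_prod_inv_one_sub`), so Todd_C(xt) = D ∏(x_j
t)·σ.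

On the other hand, repeated star subdivision writes the dual cone as a sum of duals of unimodular
cones, up to functions having a nonzero period (`exists_unimodular_decomposition`). Such functions
have generating function 0, so σ is a sum of products ∏ 1/(1 - exp(-ℓ_j t)), where the linear forms
ℓ_j in x are the rows of an integer matrix A with |det A| = D. Comparing coefficients of t^N
expresses Todd_C^N as D ∏ x_i times a sum of terms Todd^N(ℓ_1, …, ℓ_n)/∏ ℓ_j, with Todd^N the
standard Todd polynomial (`exists_eval₂_toddPoly_eq`).

Multiplication by d_{N,n} makes the numerators integral. The product of the contents of the rows of
A divides det A, so D absorbs it and only primitive denominators remain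
(`isIntegralQuotient_div_prod_linForm`). The sum is a polynomial, and by Gauss's lemma an integral
polynomial divided by a primitive one is integral whenever the quotient is a polynomial
(`IsPrim.exists_eq_map_of_mul_eq`). -/

/-- The indicator function of the half-space `{m | 0 ≤ u ⬝ᵥ m}` of `ℤⁿ`. -/
def half (u m : Fin n → ℤ) : ℤ := if 0 ≤ u ⬝ᵥ m then 1 else 0

/-- The indicator function of the dual of the cone generated by the rows of `V`. -/
def coneFn (V : Matrix (Fin n) (Fin n) ℤ) (m : Fin n → ℤ) : ℤ := ∏ i, half (V i) m

/-- The group of functions on `ℤⁿ` generated by those with a nonzero period. -/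
def negligible (n : ℕ) : AddSubgroup ((Fin n → ℤ) → ℤ) :=
  AddSubgroup.closure {f | ∃ u : Fin n → ℤ, u ≠ 0 ∧ ∀ m, f (m + u) = f m}

theorem half_add_of_dotProduct_eq_zero {v u : Fin n → ℤ} (h : v ⬝ᵥ u = 0) (m : Fin n → ℤ) :
    half v (m + u) = half v m := by
  simp [half, dotProduct_add, h]

/-- The k-th column of the adjugate works. It supplies the periods of cones from which one row has
been dropped. -/
theorem exists_ne_zero_dotProduct_eq_zero {V : Matrix (Fin n) (Fin n) ℤ} (hV : V.det ≠ 0)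
    (k : Fin n) : ∃ u : Fin n → ℤ, u ≠ 0 ∧ ∀ j, j ≠ k → V j ⬝ᵥ u = 0 := by
  have key : ∀ j, V j ⬝ᵥ (fun l => V.adjugate l k) = if j = k then V.det else 0 := by
    intro j
    have := congrFun (congrFun V.mul_adjugate j) k
    simpa [Matrix.mul_apply, dotProduct, Matrix.one_apply] using this
  refine ⟨fun l => V.adjugate l k, ?_, fun j hj => by rw [key, if_neg hj]⟩
  intro h0
  have := key k
  rw [h0] at this
  simp at this
  exact hV this.symm

theorem coneFn_updateRow (V : Matrix (Fin n) (Fin n) ℤ) (i : Fin n) (w m : Fin n → ℤ) :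
    coneFn (V.updateRow i w) m = half w m * ∏ j ∈ Finset.univ.erase i, half (V j) m := by
  rw [coneFn, ← Finset.mul_prod_erase _ _ (Finset.mem_univ i), updateRow_self]
  congr 1
  refine Finset.prod_congr rfl fun j hj => ?_
  rw [updateRow_ne (Finset.ne_of_mem_erase hj)]

theorem det_updateRow_of_smul_eq {V : Matrix (Fin n) (Fin n) ℤ} {w b : Fin n → ℤ} {D : ℤ}
    (hw : D • w = ∑ k, b k • V k) (i : Fin n) :
    D * (V.updateRow i w).det = b i * V.det := by
  rw [← det_updateRow_smul, hw, det_updateRow_sum, smul_eq_mul]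

/-- Star subdivision of a simplicial cone at a vector `w` in it, for the dual cones. -/
theorem coneFn_sub_sum_mem_negligible {V : Matrix (Fin n) (Fin n) ℤ} (hV : V.det ≠ 0)
    {w b : Fin n → ℤ} {D : ℤ} (hD : 0 < D) (hw : D • w = ∑ k, b k • V k) (hb : ∀ k, 0 ≤ b k)
    {I : Finset (Fin n)} (hI : ∀ k, k ∈ I ↔ 0 < b k) (hne : I.Nonempty) :
    coneFn V - ∑ i ∈ I, coneFn (V.updateRow i w) ∈ negligible n := by
  have hdot : ∀ m, D * (w ⬝ᵥ m) = ∑ k, b k * (V k ⬝ᵥ m) := by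
    intro m
    rw [← smul_eq_mul, ← smul_dotProduct, hw, sum_dotProduct]
    exact Finset.sum_congr rfl fun k _ => by rw [smul_dotProduct, smul_eq_mul]
  -- A positive multiple of `w` is a nonnegative combination of the rows, so `w` is nonnegative on
  -- the dual cone.
  have h1 : ∀ m, coneFn V m = half w m * coneFn V m := by
    intro m
    by_cases h : ∀ k, 0 ≤ V k ⬝ᵥ m
    · have : 0 ≤ D * (w ⬝ᵥ m) := by
        rw [hdot]
        exact Finset.sum_nonneg fun k _ => mul_nonneg (hb k) (h k)
      have : 0 ≤ w ⬝ᵥ m := nonneg_of_mul_nonneg_right this hD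
      simp [half, this]
    · push Not at h
      obtain ⟨k, hk⟩ := h
      have : coneFn V m = 0 :=
        Finset.prod_eq_zero (Finset.mem_univ k) (by simp [half, hk])
      simp [this]
  -- If every row indexed by `I` is negative at `m`, so is `w`. Expanding this vanishing product
  -- yields the subdivision.
  have h2 : ∀ m, (∏ i ∈ I, (1 + -half (V i) m)) * (half w m * ∏ i ∈ Iᶜ, half (V i) m) = 0 := by
    intro m
    by_cases hA : ∀ k ∈ I, V k ⬝ᵥ m < 0
    · have hlt : D * (w ⬝ᵥ m) < 0 := by
        rw [hdot]
        refine Finset.sum_neg' (fun k _ => ?_) ?_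
        · by_cases hk : k ∈ I
          · exact (mul_neg_of_pos_of_neg ((hI k).1 hk) (hA k hk)).le
          · have : b k = 0 := le_antisymm (not_lt.1 fun h => hk ((hI k).2 h)) (hb k)
            simp [this]
        · obtain ⟨k, hk⟩ := hne
          exact ⟨k, Finset.mem_univ k, mul_neg_of_pos_of_neg ((hI k).1 hk) (hA k hk)⟩
      have : ¬ 0 ≤ w ⬝ᵥ m := fun h => absurd (mul_nonneg hD.le h) (not_le.2 hlt)
      simp [half, this]
    · push Not at hA
      obtain ⟨k, hk, hk0⟩ := hA
      rw [Finset.prod_eq_zero hk (by simp [half, hk0]), zero_mul]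
  -- The term of the expansion that takes the summand 1 from the factors in `s`. The empty set gives
  -- the original cone, singletons give the pieces, and larger sets give periodic functions.
  let F : Finset (Fin n) → (Fin n → ℤ) → ℤ := fun s m =>
    (∏ i ∈ I \ s, -half (V i) m) * (half w m * ∏ i ∈ Iᶜ, half (V i) m)
  have hF : ∑ s ∈ I.powerset, F s = 0 := by
    ext m
    rw [Finset.sum_apply, Pi.zero_apply, ← h2 m, Finset.prod_add, Finset.sum_mul]
    simp [F]
  obtain ⟨c, hc⟩ : ∃ c, I.card = c + 1 := Nat.exists_eq_succ_of_ne_zero hne.card_pos.ne'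
  have hF0 : F ∅ = (-1) ^ (c + 1) • coneFn V := by
    ext m
    rw [Pi.smul_apply, h1 m, coneFn, ← Finset.prod_mul_prod_compl I]
    simp only [F, Finset.sdiff_empty, Finset.prod_neg, hc, smul_eq_mul]
    ring
  have hF1 : ∀ i ∈ I, F {i} = (-1) ^ c • coneFn (V.updateRow i w) := by
    intro i hi
    ext m
    have h3 : Finset.univ.erase i = I.erase i ∪ Iᶜ := by
      ext j
      by_cases hj : j ∈ I
      · simp [hj]
      · have : j ≠ i := fun h => hj (h ▸ hi)
        simp [hj, this]
    have h4 : Disjoint (I.erase i) Iᶜ :=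
      Finset.disjoint_of_subset_left (Finset.erase_subset i I) disjoint_compl_right
    rw [Pi.smul_apply, coneFn_updateRow, h3, Finset.prod_union h4]
    simp only [F, Finset.sdiff_singleton_eq_erase, Finset.prod_neg, Finset.card_erase_of_mem hi,
      hc, smul_eq_mul, Nat.add_sub_cancel]
    ring
  have hF2 : ∀ s ⊆ I, 2 ≤ s.card → F s ∈ negligible n := by
    intro s hs hcard
    obtain ⟨i, hi, k, hk, hik⟩ := Finset.one_lt_card.1 hcard
    have hdet : (V.updateRow i w).det ≠ 0 := by
      intro h0
      have := det_updateRow_of_smul_eq hw i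
      rw [h0, mul_zero] at this
      exact mul_ne_zero ((hI i).1 (hs hi)).ne' hV this.symm
    -- Both rows `i` and `k` are absent from `F s`, so a vector orthogonal to `w` and to all the
    -- other rows is a period.
    obtain ⟨u, hu0, hu⟩ := exists_ne_zero_dotProduct_eq_zero hdet k
    have huw : w ⬝ᵥ u = 0 := by simpa using hu i hik
    have huV : ∀ j, j ≠ i → j ≠ k → V j ⬝ᵥ u = 0 := by
      intro j hji hjk
      simpa [updateRow_ne hji] using hu j hjk
    refine AddSubgroup.subset_closure ⟨u, hu0, fun m => ?_⟩
    have e1 : ∏ j ∈ I \ s, -half (V j) (m + u) = ∏ j ∈ I \ s, -half (V j) m := by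
      refine Finset.prod_congr rfl fun j hj => ?_
      have hjs := (Finset.mem_sdiff.1 hj).2
      rw [half_add_of_dotProduct_eq_zero
        (huV j (fun h => hjs (h ▸ hi)) (fun h => hjs (h ▸ hk)))]
    have e2 : ∏ j ∈ Iᶜ, half (V j) (m + u) = ∏ j ∈ Iᶜ, half (V j) m := by
      refine Finset.prod_congr rfl fun j hj => ?_
      have hjI := Finset.mem_compl.1 hj
      rw [half_add_of_dotProduct_eq_zero
        (huV j (fun h => hjI (h ▸ hs hi)) (fun h => hjI (h ▸ hs hk)))]
    simp only [F, e1, e2, half_add_of_dotProduct_eq_zero huw]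
  rw [Finset.sum_powerset, hc, Finset.sum_range_succ', Finset.sum_range_succ',
    Finset.powersetCard_zero, Finset.sum_singleton, hF0, zero_add, Finset.powersetCard_one,
    Finset.sum_map, add_assoc] at hF
  simp only [Function.Embedding.coeFn_mk] at hF
  rw [Finset.sum_congr rfl hF1, ← Finset.smul_sum] at hF
  have hG : ∑ k ∈ Finset.range c, ∑ s ∈ Finset.powersetCard (k + 1 + 1) I, F s ∈ negligible n :=
    sum_mem fun k _ => sum_mem fun s hs =>
      hF2 s (Finset.mem_powersetCard.1 hs).1 (by rw [(Finset.mem_powersetCard.1 hs).2]; omega)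
  have hsq : ((-1 : ℤ) ^ c) * (-1) ^ c = 1 := by rw [← mul_pow]; simp
  have : coneFn V - ∑ i ∈ I, coneFn (V.updateRow i w) = (-1 : ℤ) ^ c •
      ∑ k ∈ Finset.range c, ∑ s ∈ Finset.powersetCard (k + 1 + 1) I, F s := by
    rw [eq_neg_of_add_eq_zero_left hF, smul_neg, smul_add, smul_smul, smul_smul, pow_succ,
      ← mul_assoc, hsq]
    simp [sub_eq_add_neg]
  rw [this]
  exact zsmul_mem hG _

/-- Dividing the adjugate by the determinant then gives an integral inverse. -/
theorem isUnit_det_of_dvd_adjugate {V : Matrix (Fin n) (Fin n) ℤ} (hV : V.det ≠ 0)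
    (h : ∀ i j, V.det ∣ V.adjugate i j) : IsUnit V.det := by
  choose B hB using h
  have h1 : V.adjugate = V.det • Matrix.of B := by
    ext i j
    simp [hB]
  have h2 : V.det • (Matrix.of B * V) = V.det • (1 : Matrix (Fin n) (Fin n) ℤ) := by
    rw [← smul_mul_assoc, ← h1, adjugate_mul]
  have h3 : Matrix.of B * V = 1 := by
    ext i j
    have := congrFun (congrFun h2 i) j
    simp only [Matrix.smul_apply, smul_eq_mul] at this
    exact mul_left_cancel₀ hV this
  have h4 := congrArg Matrix.det h3
  rw [det_mul, det_one] at h4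
  exact IsUnit.of_mul_eq_one_right _ h4

/-- If `|det V| ≠ 1` there is a nonzero lattice point in the half-open parallelepiped spanned by
the rows of `V`. -/
theorem exists_mem_parallelepiped {V : Matrix (Fin n) (Fin n) ℤ} (hV : V.det ≠ 0)
    (hu : V.det.natAbs ≠ 1) : ∃ w b : Fin n → ℤ, (V.det.natAbs : ℤ) • w = ∑ k, b k • V k ∧
      (∀ k, 0 ≤ b k ∧ b k < V.det.natAbs) ∧ ∃ k, 0 < b k := by
  have hex : ∃ i j, ¬ V.det ∣ V.adjugate i j := by
    by_contra! h
    exact hu (Int.isUnit_iff_natAbs_eq.1 (isUnit_det_of_dvd_adjugate hV h))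
  obtain ⟨i, j, hij⟩ := hex
  have hD : (0 : ℤ) < V.det.natAbs := by positivity
  -- A row of the adjugate expresses a multiple of a basis vector in the rows of `V`; reducing its
  -- coefficients modulo D moves that point into the parallelepiped. The entry not divisible by the
  -- determinant keeps a nonzero remainder.
  have hrow : ∑ k, V.adjugate i k • V k = V.det • Pi.single i 1 := by
    ext l
    have := congrFun (congrFun V.adjugate_mul i) l
    simpa [Matrix.mul_apply, Matrix.one_apply, Pi.single_apply, eq_comm] using this
  set D : ℤ := (V.det.natAbs : ℤ) with hDdef
  obtain ⟨ε, hε⟩ : ∃ ε : ℤ, V.det = D * ε := by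
    rcases Int.natAbs_eq V.det with h | h
    · exact ⟨1, by rw [mul_one]; exact h⟩
    · exact ⟨-1, by rw [mul_neg_one]; exact h⟩
  refine ⟨ε • Pi.single i 1 - ∑ k, (V.adjugate i k / D) • V k, fun k => V.adjugate i k % D,
    ?_, fun k => ⟨Int.emod_nonneg _ hD.ne', Int.emod_lt_of_pos _ hD⟩, j, ?_⟩
  · rw [smul_sub, smul_smul, ← hε, ← hrow, Finset.smul_sum, ← Finset.sum_sub_distrib]
    refine Finset.sum_congr rfl fun k _ => ?_
    rw [smul_smul, ← sub_smul]
    exact congrArg (· • V k) (Int.emod_def _ _).symm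
  · refine lt_of_le_of_ne (Int.emod_nonneg _ hD.ne') fun h => hij ?_
    exact Int.natAbs_dvd.1 (Int.dvd_of_emod_eq_zero h.symm)

/-- The dual of a simplicial cone is, up to negligible functions, a sum of duals of unimodular
cones. -/
theorem exists_unimodular_decomposition (V : Matrix (Fin n) (Fin n) ℤ) (hV : V.det ≠ 0) :
    ∃ l : List (Matrix (Fin n) (Fin n) ℤ), (∀ W ∈ l, W.det.natAbs = 1) ∧
      coneFn V - (l.map coneFn).sum ∈ negligible n := by
  induction hd : V.det.natAbs using Nat.strong_induction_on generalizing V with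
  | _ d ih =>
  by_cases hu : V.det.natAbs = 1
  · exact ⟨[V], by simpa using hu, by simp [zero_mem]⟩
  obtain ⟨w, b, hw, hb, k, hk⟩ := exists_mem_parallelepiped hV hu
  have hD : (0 : ℤ) < V.det.natAbs := by positivity
  let I : Finset (Fin n) := Finset.univ.filter fun k => 0 < b k
  have hI : ∀ k, k ∈ I ↔ 0 < b k := by simp [I]
  have hstar := coneFn_sub_sum_mem_negligible hV hD hw (fun k => (hb k).1) hI ⟨k, (hI k).2 hk⟩
  have hsub : ∀ i ∈ I, ∃ l : List (Matrix (Fin n) (Fin n) ℤ), (∀ W ∈ l, W.det.natAbs = 1) ∧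
      coneFn (V.updateRow i w) - (l.map coneFn).sum ∈ negligible n := by
    intro i hi
    have hdet := det_updateRow_of_smul_eq hw i
    have hne : (V.updateRow i w).det ≠ 0 := by
      intro h0
      rw [h0, mul_zero] at hdet
      exact mul_ne_zero ((hI i).1 hi).ne' hV hdet.symm
    refine ih _ ?_ _ hne rfl
    -- The piece has determinant `b i` up to sign, smaller than that of `V` because `w` lies in the
    -- half-open parallelepiped.
    have h1 := congrArg Int.natAbs hdet
    rw [Int.natAbs_mul, Int.natAbs_mul, Int.natAbs_natCast, mul_comm] at h1
    have h2 : (b i).natAbs < V.det.natAbs := by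
      have := hb i
      omega
    rw [Nat.eq_of_mul_eq_mul_right (by omega) h1, ← hd]
    exact h2
  choose! l hl1 hl2 using hsub
  have hgen : ∀ J ⊆ I, ∃ L : List (Matrix (Fin n) (Fin n) ℤ), (∀ W ∈ L, W.det.natAbs = 1) ∧
      ∑ i ∈ J, coneFn (V.updateRow i w) - (L.map coneFn).sum ∈ negligible n := by
    intro J
    induction J using Finset.induction_on with
    | empty => exact fun _ => ⟨[], by simp, by simp [zero_mem]⟩
    | insert i J hi ihJ =>
      intro hJ
      obtain ⟨L, hL1, hL2⟩ := ihJ ((Finset.subset_insert i J).trans hJ)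
      have hiI := hJ (Finset.mem_insert_self i J)
      refine ⟨l i ++ L, ?_, ?_⟩
      · intro W hW
        rcases List.mem_append.1 hW with h | h
        · exact hl1 i hiI W h
        · exact hL1 W h
      · rw [Finset.sum_insert hi, List.map_append, List.sum_append, add_sub_add_comm]
        exact add_mem (hl2 i hiI) hL2
  obtain ⟨L, hL1, hL2⟩ := hgen I subset_rfl
  refine ⟨L, hL1, ?_⟩
  have := add_mem hstar hL2
  rwa [sub_add_sub_cancel] at this

end Decomposition

/-! ### Sums of rational generating functions over lattice points -/

section GeneratingFunction

variable {n : ℕ} {L : Type*} [Field L] (z : Multiplicative (Fin n → ℤ) →* L)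

/-- Translation of functions on `ℤⁿ`. -/
def translate (n : ℕ) :
    Multiplicative (Fin n → ℤ) →* Module.End ℤ ((Fin n → ℤ) → ℤ) where
  toFun u :=
    { toFun := fun f m => f (m - u.toAdd)
      map_add' := fun _ _ => rfl
      map_smul' := fun _ _ => rfl }
  map_one' := by
    ext f m
    simp
  map_mul' u v := by
    ext f m
    simp [sub_sub]

/-- The convolution action of the group ring `ℤ[ℤⁿ]` on functions on `ℤⁿ`. -/
def act (n : ℕ) :
    AddMonoidAlgebra ℤ (Fin n → ℤ) →ₐ[ℤ] Module.End ℤ ((Fin n → ℤ) → ℤ) :=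
  AddMonoidAlgebra.lift ℤ _ _ (translate n)

/-- Evaluation of the group ring at the character `z`. -/
def ev : AddMonoidAlgebra ℤ (Fin n → ℤ) →ₐ[ℤ] L := AddMonoidAlgebra.lift ℤ _ _ z

/-- `f` has generating function `s`, i.e. `∑ m, f m * z m = s` in the sense of rational
functions: `f` becomes finitely supported after multiplication by an element of the group ring
on which `z` does not vanish. -/
def HasGenSum (f : (Fin n → ℤ) → ℤ) (s : L) : Prop :=
  ∃ P Q : AddMonoidAlgebra ℤ (Fin n → ℤ), ev z P ≠ 0 ∧ act n P f = ⇑Q.coeff ∧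
    ev z Q = s * ev z P

theorem act_single (u : Fin n → ℤ) (a : ℤ) (f : (Fin n → ℤ) → ℤ) (m : Fin n → ℤ) :
    act n (AddMonoidAlgebra.single u a) f m = a * f (m - u) := by
  simp [act, AddMonoidAlgebra.lift_single, translate]

theorem ev_single (u : Fin n → ℤ) (a : ℤ) :
    ev z (AddMonoidAlgebra.single u a) = a * z (Multiplicative.ofAdd u) := by
  simp [ev, AddMonoidAlgebra.lift_single]

theorem act_coeff (P Q : AddMonoidAlgebra ℤ (Fin n → ℤ)) :
    act n P ⇑Q.coeff = ⇑(P * Q).coeff := by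
  induction P using AddMonoidAlgebra.induction_linear with
  | zero => simp
  | add f g hf hg =>
    rw [map_add, LinearMap.add_apply, hf, hg, add_mul]
    rfl
  | single u a =>
    ext m
    rw [act_single, AddMonoidAlgebra.coeff_single_mul_apply, sub_eq_neg_add]

variable {z}

/-- The product of the two multipliers serves both functions, since the group ring is commutative
and `z` takes values in a field. -/
theorem HasGenSum.add {f g : (Fin n → ℤ) → ℤ} {s t : L} (hf : HasGenSum z f s)
    (hg : HasGenSum z g t) : HasGenSum z (f + g) (s + t) := by
  obtain ⟨P, Q, h1, h2, h3⟩ := hf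
  obtain ⟨P', Q', h1', h2', h3'⟩ := hg
  refine ⟨P * P', P' * Q + P * Q', ?_, ?_, ?_⟩
  · rw [map_mul]
    exact mul_ne_zero h1 h1'
  · rw [map_add]
    nth_rewrite 1 [mul_comm P P']
    rw [map_mul, map_mul, Module.End.mul_apply, Module.End.mul_apply, h2, h2', act_coeff,
      act_coeff]
    rfl
  · rw [map_add, map_mul, map_mul, map_mul, h3, h3']
    ring

theorem HasGenSum.neg {f : (Fin n → ℤ) → ℤ} {s : L} (hf : HasGenSum z f s) :
    HasGenSum z (-f) (-s) := by
  obtain ⟨P, Q, h1, h2, h3⟩ := hf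
  refine ⟨P, -Q, h1, ?_, ?_⟩
  · rw [map_neg, h2]
    rfl
  · rw [map_neg, h3, neg_mul]

theorem hasGenSum_zero : HasGenSum z 0 0 :=
  ⟨1, 0, by simp, by rw [map_zero]; rfl, by simp⟩

theorem HasGenSum.list_sum {ι : Type*} {l : List ι} {f : ι → (Fin n → ℤ) → ℤ} {s : ι → L}
    (h : ∀ i ∈ l, HasGenSum z (f i) (s i)) : HasGenSum z (l.map f).sum (l.map s).sum := by
  induction l with
  | nil => simpa using hasGenSum_zero
  | cons i l ih =>
    simp only [List.map_cons, List.sum_cons]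
    exact (h i List.mem_cons_self).add (ih fun j hj => h j (List.mem_cons_of_mem i hj))

/-- This makes generating functions well defined: whichever multiplier is used, the zero function
goes to the zero element of the group ring. -/
theorem HasGenSum.eq_zero {s : L} (h : HasGenSum z 0 s) : s = 0 := by
  obtain ⟨P, Q, h1, h2, h3⟩ := h
  have hQ : Q = 0 := by
    rw [map_zero] at h2
    ext m
    exact (congrFun h2 m).symm
  rw [hQ, map_zero] at h3
  exact (mul_eq_zero.1 h3.symm).resolve_right h1

theorem HasGenSum.unique {f : (Fin n → ℤ) → ℤ} {s t : L} (h : HasGenSum z f s)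
    (h' : HasGenSum z f t) : s = t := by
  have := h.add h'.neg
  rw [add_neg_cancel] at this
  exact eq_of_sub_eq_zero (by simpa [sub_eq_add_neg] using this.eq_zero)

/-- The element 1 - [u] annihilates functions of period `u`, while `z` does not vanish on it. -/
theorem hasGenSum_of_mem_negligible (hz : ∀ u : Fin n → ℤ, u ≠ 0 → z (Multiplicative.ofAdd u) ≠ 1)
    {f : (Fin n → ℤ) → ℤ} (hf : f ∈ negligible n) : HasGenSum z f 0 := by
  induction hf using AddSubgroup.closure_induction with
  | mem f hf =>
    obtain ⟨u, hu, h⟩ := hf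
    refine ⟨1 - AddMonoidAlgebra.single u 1, 0, ?_, ?_, by simp⟩
    · rw [map_sub, map_one, ev_single, Int.cast_one, one_mul]
      exact sub_ne_zero.2 (hz u hu).symm
    · ext m
      rw [map_sub, map_one, LinearMap.sub_apply, Pi.sub_apply, act_single, ← h (m - u)]
      simp
  | zero => exact hasGenSum_zero
  | add f g _ _ hf hg => simpa using hf.add hg
  | neg f _ hf => simpa using hf.neg

/-- The indicator function of the slab `{m | 0 ≤ v ⬝ᵥ m < Q}`. -/
def slab (Q : ℤ) (v m : Fin n → ℤ) : ℤ := if 0 ≤ v ⬝ᵥ m ∧ v ⬝ᵥ m < Q then 1 else 0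

/-- Translation by `u j` changes only the pairing with `V j`, by `Q`. Hence 1 - [u j] cuts the j-th
half-space down to a slab and leaves the other factors alone. -/
theorem act_prod_coneFn {V : Matrix (Fin n) (Fin n) ℤ} {Q : ℤ} (hQ : 0 < Q)
    {u : Fin n → Fin n → ℤ} (hu : ∀ i j, V i ⬝ᵥ u j = if i = j then Q else 0)
    (s : Finset (Fin n)) (m : Fin n → ℤ) :
    act n (∏ j ∈ s, (1 - AddMonoidAlgebra.single (u j) 1)) (coneFn V) m =
      (∏ j ∈ s, slab Q (V j) m) * ∏ j ∈ sᶜ, half (V j) m := by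
  induction s using Finset.induction_on generalizing m with
  | empty => simp [coneFn]
  | insert j s hj ih =>
    have hjs : j ∈ sᶜ := Finset.mem_compl.2 hj
    rw [Finset.prod_insert hj, map_mul, Module.End.mul_apply, map_sub, map_one,
      LinearMap.sub_apply, Pi.sub_apply, act_single, one_mul, Module.End.one_apply, ih, ih,
      Finset.prod_insert hj, Finset.compl_insert, ← Finset.mul_prod_erase _ _ hjs,
      ← Finset.mul_prod_erase _ _ hjs]
    have e0 : ∀ i, i ≠ j → V i ⬝ᵥ (m - u j) = V i ⬝ᵥ m := by
      intro i hi
      rw [dotProduct_sub, hu, if_neg hi, sub_zero]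
    have e1 : ∏ i ∈ s, slab Q (V i) (m - u j) = ∏ i ∈ s, slab Q (V i) m :=
      Finset.prod_congr rfl fun i hi => by
        rw [slab, e0 i (fun h => hj (h ▸ hi)), slab]
    have e2 : ∏ i ∈ sᶜ.erase j, half (V i) (m - u j) = ∏ i ∈ sᶜ.erase j, half (V i) m :=
      Finset.prod_congr rfl fun i hi => by
        rw [half, e0 i (Finset.ne_of_mem_erase hi), half]
    have e3 : half (V j) m - half (V j) (m - u j) = slab Q (V j) m := by
      simp only [half, slab, dotProduct_sub, hu, if_true]
      split_ifs <;> omega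
    rw [e1, e2, ← e3]
    ring

/-- With all n multipliers applied, the cone is cut down to the finite box `B`. -/
theorem hasGenSum_coneFn {V : Matrix (Fin n) (Fin n) ℤ} {Q : ℤ} (hQ : 0 < Q)
    {u : Fin n → Fin n → ℤ} (hu : ∀ i j, V i ⬝ᵥ u j = if i = j then Q else 0)
    (hz : ∀ j, z (Multiplicative.ofAdd (u j)) ≠ 1) {B : Finset (Fin n → ℤ)}
    (hB : ∀ m, m ∈ B ↔ ∀ i, 0 ≤ V i ⬝ᵥ m ∧ V i ⬝ᵥ m < Q) :
    HasGenSum z (coneFn V) ((∑ m ∈ B, z (Multiplicative.ofAdd m)) /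
      ∏ j, (1 - z (Multiplicative.ofAdd (u j)))) := by
  have hev : ev z (∏ j, (1 - AddMonoidAlgebra.single (u j) 1)) =
      ∏ j, (1 - z (Multiplicative.ofAdd (u j))) := by
    rw [map_prod]
    refine Finset.prod_congr rfl fun j _ => ?_
    rw [map_sub, map_one, ev_single, Int.cast_one, one_mul]
  have hne : ∏ j, (1 - z (Multiplicative.ofAdd (u j))) ≠ 0 :=
    Finset.prod_ne_zero_iff.2 fun j _ => sub_ne_zero.2 (hz j).symm
  refine ⟨∏ j, (1 - AddMonoidAlgebra.single (u j) 1),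
    ∑ m ∈ B, AddMonoidAlgebra.single m 1, by rwa [hev], ?_, ?_⟩
  · ext m
    rw [act_prod_coneFn hQ hu, AddMonoidAlgebra.coeff_sum, Finset.sum_apply']
    simp only [AddMonoidAlgebra.coeff_single, Finsupp.single_apply, Finset.compl_univ,
      Finset.prod_empty, mul_one, Finset.sum_ite_eq', slab]
    by_cases hm : m ∈ B
    · rw [if_pos hm]
      exact Finset.prod_eq_one fun i _ => if_pos ((hB m).1 hm i)
    · rw [if_neg hm]
      rw [hB] at hm
      push Not at hm
      obtain ⟨i, hi⟩ := hm
      exact Finset.prod_eq_zero (Finset.mem_univ i) (if_neg fun h => absurd h.2 (not_lt.2 (hi h.1)))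
  · rw [hev, map_sum, div_mul_cancel₀ _ hne]
    refine Finset.sum_congr rfl fun m _ => ?_
    rw [ev_single, Int.cast_one, one_mul]

theorem eq_of_forall_dotProduct_eq {V : Matrix (Fin n) (Fin n) ℤ} (hV : V.det ≠ 0)
    {m m' : Fin n → ℤ} (h : ∀ i, V i ⬝ᵥ m = V i ⬝ᵥ m') : m = m' := by
  have h0 : V *ᵥ (m - m') = 0 := by
    ext i
    simp [mulVec, dotProduct_sub, h i]
  exact eq_of_sub_eq_zero (eq_zero_of_mulVec_eq_zero hV h0)

theorem exists_dual_vectors (V : Matrix (Fin n) (Fin n) ℤ) :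
    ∃ u : Fin n → Fin n → ℤ, ∀ i j, V i ⬝ᵥ u j = if i = j then (V.det.natAbs : ℤ) else 0 := by
  have key : ∀ i j, V i ⬝ᵥ (fun l => V.adjugate l j) = if i = j then V.det else 0 := by
    intro i j
    have := congrFun (congrFun V.mul_adjugate i) j
    simpa [Matrix.mul_apply, dotProduct, Matrix.one_apply] using this
  -- Columns of the adjugate, with the sign that makes the pairing positive.
  refine ⟨fun j => V.det.sign • fun l => V.adjugate l j, fun i j => ?_⟩
  rw [dotProduct_smul, key]
  split_ifs
  · rw [smul_eq_mul, Int.sign_mul_self_eq_natAbs]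
  · simp

/-- The generating function of the dual of a unimodular cone. -/
theorem hasGenSum_coneFn_of_unimodular
    (hz : ∀ u : Fin n → ℤ, u ≠ 0 → z (Multiplicative.ofAdd u) ≠ 1)
    {V : Matrix (Fin n) (Fin n) ℤ} {u : Fin n → Fin n → ℤ} (hV : V.det ≠ 0)
    (hu : ∀ i j, V i ⬝ᵥ u j = if i = j then 1 else 0) :
    HasGenSum z (coneFn V) (∏ j, (1 - z (Multiplicative.ofAdd (u j))))⁻¹ := by
  have hB : ∀ m, m ∈ ({0} : Finset (Fin n → ℤ)) ↔ ∀ i, 0 ≤ V i ⬝ᵥ m ∧ V i ⬝ᵥ m < 1 := by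
    intro m
    rw [Finset.mem_singleton]
    refine ⟨fun h => by simp [h], fun h => eq_of_forall_dotProduct_eq hV fun i => ?_⟩
    rw [dotProduct_zero]
    have := h i
    omega
  have := hasGenSum_coneFn one_pos hu (fun j => hz _ fun h => ?_) hB
  · simpa using this
  · have := hu j j
    simp [h] at this

end GeneratingFunction

/-! ### Character sums over `Γ_C` -/

namespace SimplicialCone

variable {n : ℕ} (C : SimplicialCone n)

theorem det_of_gen : (Matrix.of C.gen).det = C.M.det :=
  (det_transpose (Matrix.of C.gen)).symm

theorem card_Gamma : Fintype.card C.Gamma = C.M.det.natAbs := by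
  rw [← Nat.card_eq_fintype_card, ← Submodule.natAbs_det_basis_change (Pi.basisFun ℤ (Fin n))
    C.lattice (Module.Basis.span C.linearIndependent_gen), Module.Basis.det_apply]
  congr 2
  ext i j
  simp only [Module.Basis.toMatrix_apply, Function.comp_apply, Pi.basisFun_repr, M, of_apply]
  exact congrFun (congrArg Subtype.val (Module.Basis.span_apply C.linearIndependent_gen j)) i

theorem char_mk (j : Fin n) (v : Fin n → ℤ) :
    C.char j (Submodule.Quotient.mk v) = Complex.exp (2 * Real.pi * Complex.I * C.coord j v) :=
  rfl

/-- The character `χ_j` as an additive character. -/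
def addChar (j : Fin n) : AddChar C.Gamma ℂ where
  toFun := C.char j
  map_zero_eq_one' := by
    rw [← Submodule.Quotient.mk_zero, char_mk]
    simp
  map_add_eq_mul' a b := by
    induction a using Submodule.Quotient.induction_on
    induction b using Submodule.Quotient.induction_on
    rw [← Submodule.Quotient.mk_add, char_mk, char_mk, char_mk, ← Complex.exp_add, map_add, mul_add]

theorem char_pow_card (j : Fin n) (γ : C.Gamma) : C.char j γ ^ Fintype.card C.Gamma = 1 := by
  have := (C.addChar j).map_nsmul_eq_pow (Fintype.card C.Gamma) γ
  rw [card_nsmul_eq_zero, AddChar.map_zero_eq_one] at this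
  exact this.symm

theorem sum_coord_mul_gen (v : Fin n → ℤ) (l : Fin n) :
    ∑ j, C.coord j v * (C.gen j l : ℂ) = v l := by
  have h : C.MC * C.MC⁻¹ = 1 :=
    Matrix.mul_nonsing_inv _ (isUnit_iff_ne_zero.mpr C.det_MC_ne_zero)
  have h2 : C.MC *ᵥ (C.MC⁻¹ *ᵥ fun k => (v k : ℂ)) = fun k => (v k : ℂ) := by
    rw [mulVec_mulVec, h, one_mulVec]
  rw [← congrFun h2 l]
  exact Finset.sum_congr rfl fun j _ => mul_comm _ _

theorem prod_char_pow_mk (k : Fin n → ℕ) (v : Fin n → ℤ) :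
    ∏ j, C.char j (Submodule.Quotient.mk v) ^ k j =
      Complex.exp ((∑ j, k j * C.coord j v) * (2 * Real.pi * Complex.I)) := by
  rw [Finset.sum_mul, Complex.exp_sum]
  refine Finset.prod_congr rfl fun j _ => ?_
  rw [char_mk, ← Complex.exp_nat_mul]
  ring_nf

-- Orthogonality: the product of the χ_j^{k_j} is a character of Γ_C, whose sum is |Γ_C| or 0. It is
-- trivial exactly when v ↦ ∑ k_j a_j(v) is integral on ℤⁿ, that is, when it is the pairing with
-- some `m` in ℤⁿ.
open Classical in
theorem sum_prod_char_pow (k : Fin n → ℕ) :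
    ∑ γ : C.Gamma, ∏ j, C.char j γ ^ k j =
      if ∃ m : Fin n → ℤ, ∀ i, C.gen i ⬝ᵥ m = k i then (Fintype.card C.Gamma : ℂ) else 0 := by
  have h1 : ∀ γ, ∏ j, C.char j γ ^ k j = (∏ j, C.addChar j ^ k j) γ := by
    intro γ
    simp only [AddChar.prod_apply, AddChar.pow_apply]
    rfl
  -- For additive characters, `0` denotes the trivial character.
  have h2 : ∏ j, C.addChar j ^ k j = 0 ↔ ∃ m : Fin n → ℤ, ∀ i, C.gen i ⬝ᵥ m = k i := by
    have h3 : ∏ j, C.addChar j ^ k j = 0 ↔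
        ∀ v : Fin n → ℤ, ∃ a : ℤ, ∑ j, (k j : ℂ) * C.coord j v = a := by
      rw [DFunLike.ext_iff]
      refine (Submodule.Quotient.mk_surjective C.lattice).forall.trans (forall_congr' fun v => ?_)
      rw [← h1, AddChar.zero_apply, prod_char_pow_mk, Complex.exp_eq_one_iff]
      exact exists_congr fun a => mul_left_inj' Complex.two_pi_I_ne_zero
    rw [h3]
    constructor
    · intro h
      choose a ha using h
      refine ⟨fun l => a (Pi.single l 1), fun i => ?_⟩
      have h4 : (((C.gen i ⬝ᵥ fun l => a (Pi.single l 1) : ℤ)) : ℂ) = (k i : ℤ) := by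
        simp only [dotProduct, Int.cast_sum, Int.cast_mul, ← ha]
        simp only [Finset.mul_sum]
        rw [Finset.sum_comm]
        have h5 : ∀ j, ∑ l, (C.gen i l : ℂ) * (k j * C.coord j (Pi.single l 1)) =
            k j * C.coord j (C.gen i) := by
          intro j
          conv_rhs => rw [LinearMap.pi_apply_eq_sum_univ (C.coord j) (C.gen i), Finset.mul_sum]
          refine Finset.sum_congr rfl fun l _ => ?_
          rw [zsmul_eq_mul]
          have : (fun j => if l = j then (1 : ℤ) else 0) = Pi.single l 1 := by
            ext j
            simp [Pi.single_apply, eq_comm]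
          rw [this]
          ring
        simp [h5, coord_gen]
      exact_mod_cast h4
    · rintro ⟨m, hm⟩ v
      refine ⟨v ⬝ᵥ m, ?_⟩
      simp only [dotProduct, Int.cast_sum, Int.cast_mul, ← C.sum_coord_mul_gen v, Finset.sum_mul]
      rw [Finset.sum_comm]
      refine Finset.sum_congr rfl fun j _ => ?_
      have : (k j : ℂ) = ((C.gen j ⬝ᵥ m : ℤ) : ℂ) := by rw [hm j]; simp
      rw [this, dotProduct, Int.cast_sum, Finset.sum_mul]
      refine Finset.sum_congr rfl fun l _ => ?_
      push_cast
      ring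
  simp only [h1]
  rw [AddChar.sum_eq_ite]
  simp only [h2]

theorem exists_box_finset {V : Matrix (Fin n) (Fin n) ℤ} (hV : V.det ≠ 0) (Q : ℤ) :
    ∃ B : Finset (Fin n → ℤ), ∀ m, m ∈ B ↔ ∀ i, 0 ≤ V i ⬝ᵥ m ∧ V i ⬝ᵥ m < Q := by
  have hfin : {m : Fin n → ℤ | ∀ i, 0 ≤ V i ⬝ᵥ m ∧ V i ⬝ᵥ m < Q}.Finite := by
    refine Set.Finite.of_finite_image (f := fun m i => V i ⬝ᵥ m)
      ((Set.finite_Icc (0 : Fin n → ℤ) fun _ => Q).subset ?_)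
      fun m _ m' _ h => eq_of_forall_dotProduct_eq hV (congrFun h)
    rintro _ ⟨m, hm, rfl⟩
    exact ⟨fun i => (hm i).1, fun i => (hm i).2.le⟩
  exact ⟨hfin.toFinset, by simp⟩

/-- The sum over `Γ_C` of the products of geometric series is `|Γ_C|` times the generating function
of the dual cone. -/
theorem sum_prod_inv_one_sub {L : Type*} [Field L] (φ : ℂ →+* L) (E : Fin n → L)
    (hE : ∀ j, E j ^ Fintype.card C.Gamma ≠ 1) {B : Finset (Fin n → ℤ)}
    (hB : ∀ m, m ∈ B ↔ ∀ i, 0 ≤ C.gen i ⬝ᵥ m ∧ C.gen i ⬝ᵥ m < Fintype.card C.Gamma) :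
    ∑ γ : C.Gamma, ∏ j, (1 - φ (C.char j γ) * E j)⁻¹ =
      Fintype.card C.Gamma * ((∑ m ∈ B, ∏ j, E j ^ (C.gen j ⬝ᵥ m).toNat) /
        ∏ j, (1 - E j ^ Fintype.card C.Gamma)) := by
  classical
  set Q := Fintype.card C.Gamma with hQ
  have hne : ∀ j, 1 - E j ^ Q ≠ 0 := fun j => sub_ne_zero.2 (hE j).symm
  -- Since χ^Q = 1, a finite geometric sum gives a denominator independent of γ.
  have h1 : ∀ γ j, (1 - φ (C.char j γ) * E j)⁻¹ =
      (∑ k ∈ Finset.range Q, (φ (C.char j γ) * E j) ^ k) / (1 - E j ^ Q) := by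
    intro γ j
    have h2 := mul_neg_geom_sum (φ (C.char j γ) * E j) Q
    have h3 : (φ (C.char j γ) * E j) ^ Q = E j ^ Q := by
      rw [mul_pow, ← map_pow, char_pow_card, map_one, one_mul]
    rw [h3] at h2
    have h4 : 1 - φ (C.char j γ) * E j ≠ 0 := by
      intro h
      rw [h, zero_mul] at h2
      exact hne j h2.symm
    rw [eq_div_iff (hne j), ← h2, inv_mul_cancel_left₀ h4]
  simp only [h1, Finset.prod_div_distrib]
  rw [← Finset.sum_div, mul_div_assoc']
  congr 1
  simp only [Finset.prod_univ_sum]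
  rw [Finset.sum_comm]
  have h5 : ∀ k : Fin n → ℕ, ∑ γ : C.Gamma, ∏ j, (φ (C.char j γ) * E j) ^ k j =
      if ∃ m : Fin n → ℤ, ∀ i, C.gen i ⬝ᵥ m = k i then (Q : L) * ∏ j, E j ^ k j else 0 := by
    intro k
    have := congrArg φ (C.sum_prod_char_pow k)
    simp only [mul_pow, Finset.prod_mul_distrib]
    rw [← Finset.sum_mul]
    simp only [map_sum, map_prod, map_pow] at this
    rw [this]
    split_ifs
    · simp [hQ]
    · simp
  simp only [h5]
  rw [← Finset.sum_filter, Finset.mul_sum]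
  symm
  -- The exponent vectors surviving orthogonality are the pairings of the generators with the points
  -- of `B`.
  refine Finset.sum_bij (fun m _ j => (C.gen j ⬝ᵥ m).toNat) ?_ ?_ ?_ ?_
  · intro m hm
    rw [hB] at hm
    simp only [Finset.mem_filter, Fintype.mem_piFinset, Finset.mem_range]
    refine ⟨fun j => ?_, m, fun j => (Int.toNat_of_nonneg (hm j).1).symm⟩
    have := hm j
    omega
  · intro m hm m' hm' h
    rw [hB] at hm hm'
    refine eq_of_forall_dotProduct_eq (V := Matrix.of C.gen)
      (by rw [det_of_gen]; exact C.det_ne_zero) fun i => ?_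
    have : (C.gen i ⬝ᵥ m).toNat = (C.gen i ⬝ᵥ m').toNat := congrFun h i
    have h1 := hm i
    have h2 := hm' i
    change C.gen i ⬝ᵥ m = C.gen i ⬝ᵥ m'
    omega
  · intro k hk
    simp only [Finset.mem_filter, Fintype.mem_piFinset, Finset.mem_range] at hk
    obtain ⟨hk, m, hm⟩ := hk
    refine ⟨m, (hB m).2 fun i => ?_, ?_⟩
    · rw [hm]
      have := hk i
      omega
    · ext j
      simp [hm]
  · intro m _
    rfl

end SimplicialCone

/-! ### Todd series along a line -/

section Line

/-- The i-th factor involves only the i-th variable, so a single way of splitting `r` contributes.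
-/
theorem coeff_prod_subst {F : Type*} [CommRing F] {n : ℕ} (f : Fin n → PowerSeries F)
    (r : Fin n →₀ ℕ) :
    MvPowerSeries.coeff r (∏ i, PowerSeries.subst (MvPowerSeries.X i : MvPowerSeries (Fin n) F)
      (f i)) = ∏ i, PowerSeries.coeff (r i) (f i) := by
  classical
  rw [MvPowerSeries.coeff_prod]
  simp only [PowerSeries.coeff_subst_single]
  rw [Finset.sum_eq_single (Finsupp.equivFunOnFinite.symm fun i => Finsupp.single i (r i))]
  · refine Finset.prod_congr rfl fun i _ => ?_
    simp
  · intro l hl hne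
    by_contra h0
    have h1 : ∀ i, l i = Finsupp.single i (l i i) := by
      intro i
      by_contra h
      exact h0 (Finset.prod_eq_zero (Finset.mem_univ i) (if_neg h))
    refine hne (Finsupp.ext fun i => ?_)
    rw [Finsupp.equivFunOnFinite_symm_apply_apply, ← (Finset.mem_finsuppAntidiag.1 hl).1, h1 i]
    congr 1
    rw [Finsupp.finsetSum_apply, Finset.sum_eq_single_of_mem i (Finset.mem_univ i)]
    intro j _ hj
    rw [h1 j, Finsupp.single_eq_of_ne hj.symm]
  · intro h
    refine absurd ?_ h
    rw [Finset.mem_finsuppAntidiag]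
    refine ⟨?_, by simp⟩
    ext i
    simp

theorem homogPart_sum {F ι : Type*} [CommSemiring F] {n : ℕ} (s : Finset ι)
    (f : ι → MvPowerSeries (Fin n) F) (N : ℕ) :
    homogPart (∑ i ∈ s, f i) N = ∑ i ∈ s, homogPart (f i) N := by
  simp only [homogPart, map_sum]
  rw [Finset.sum_comm]

/-- Replacing each variable by `x i` times t turns the part of degree N into the coefficient of t^N,
which reduces everything to series in one variable. -/
theorem eval₂_homogPart {F K : Type*} [CommRing F] [CommRing K] (φ : F →+* K) {n : ℕ}
    (f : Fin n → PowerSeries F) (x : Fin n → K) (N : ℕ) :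
    MvPolynomial.eval₂ φ x (homogPart (∏ i, PowerSeries.subst
      (MvPowerSeries.X i : MvPowerSeries (Fin n) F) (f i)) N) =
      PowerSeries.coeff N (∏ i, PowerSeries.rescale (x i) (PowerSeries.map φ (f i))) := by
  rw [PowerSeries.coeff_prod, homogPart, MvPolynomial.eval₂_sum]
  refine Finset.sum_congr rfl fun r _ => ?_
  rw [MvPolynomial.eval₂_monomial, coeff_prod_subst, map_prod, Finsupp.prod_fintype _ _ (by simp),
    ← Finset.prod_mul_distrib]
  refine Finset.prod_congr rfl fun i _ => ?_
  rw [PowerSeries.coeff_rescale, PowerSeries.coeff_map, mul_comm]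

variable {K : Type*} [Field K] [Algebra ℚ K]

/-- The power series `exp (-a t)`. -/
def expNeg (a : K) : PowerSeries K := PowerSeries.rescale (-a) (PowerSeries.exp K)

theorem expNeg_zero : expNeg (0 : K) = 1 := by
  simp [expNeg]

theorem expNeg_add (a b : K) : expNeg (a + b) = expNeg a * expNeg b := by
  rw [expNeg, neg_add, ← PowerSeries.exp_mul_exp_eq_exp_add]
  rfl

theorem expNeg_ne_one {a : K} (ha : a ≠ 0) : expNeg a ≠ 1 := by
  intro h
  have := congrArg (PowerSeries.coeff 1) h
  simp [expNeg, PowerSeries.coeff_rescale, PowerSeries.coeff_exp, PowerSeries.coeff_one, ha] at this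

theorem expNeg_natCast_mul (k : ℕ) (a : K) : expNeg (k * a) = expNeg a ^ k := by
  induction k with
  | zero => simp [expNeg_zero]
  | succ k ih => rw [Nat.cast_succ, add_mul, one_mul, expNeg_add, ih, pow_succ]

theorem expNeg_sum {ι : Type*} (s : Finset ι) (a : ι → K) :
    expNeg (∑ i ∈ s, a i) = ∏ i ∈ s, expNeg (a i) := by
  classical
  induction s using Finset.induction_on with
  | empty => simp [expNeg_zero]
  | insert i s hi ih => rw [Finset.sum_insert hi, Finset.prod_insert hi, expNeg_add, ih]

theorem rescale_toddFactor_mul {F : Type*} [Field F] [Algebra ℚ F] (φ : F →+* K) (c : F) (a : K) :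
    PowerSeries.rescale a (PowerSeries.map φ (toddFactor c)) *
      (1 - PowerSeries.C (φ c) * expNeg a) = PowerSeries.C a * PowerSeries.X := by
  have h := congrArg (fun f => PowerSeries.rescale a (PowerSeries.map φ f)) (toddFactor_mul c)
  simp only [map_mul, PowerSeries.map_X] at h
  have h2 : PowerSeries.rescale a (PowerSeries.map φ (oneSubMulExpNeg c)) =
      1 - PowerSeries.C (φ c) * expNeg a := by
    have h3 : PowerSeries.rescale a (PowerSeries.map φ (PowerSeries.evalNegHom
        (PowerSeries.exp F))) = expNeg a := by
      rw [expNeg, PowerSeries.evalNegHom, ← PowerSeries.rescale_map,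
        PowerSeries.map_exp, PowerSeries.rescale_rescale]
      simp
    have h4 : PowerSeries.rescale a (PowerSeries.C (φ c)) = PowerSeries.C (φ c) := by
      ext k
      rw [PowerSeries.coeff_rescale, PowerSeries.coeff_C]
      split_ifs with hk
      · simp [hk]
      · simp
    rw [oneSubMulExpNeg, map_sub, map_sub, map_one, map_one, map_mul, map_mul, h3,
      PowerSeries.map_C, h4]
  rw [h2, PowerSeries.rescale_X] at h
  exact h

/-- In the fraction field the factor at can be divided out, which treats c = 1, where there is a
pole at t = 0, and c ≠ 1 alike. -/
theorem inv_one_sub_eq {F : Type*} [Field F] [Algebra ℚ F] (φ : F →+* K) (c : F) {a : K}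
    (ha : a ≠ 0) :
    (1 - algebraMap (PowerSeries K) (FractionRing (PowerSeries K)) (PowerSeries.C (φ c)) *
      algebraMap (PowerSeries K) (FractionRing (PowerSeries K)) (expNeg a))⁻¹ =
    algebraMap (PowerSeries K) (FractionRing (PowerSeries K))
      (PowerSeries.rescale a (PowerSeries.map φ (toddFactor c))) /
    algebraMap (PowerSeries K) (FractionRing (PowerSeries K)) (PowerSeries.C a * PowerSeries.X) := by
  have h := rescale_toddFactor_mul φ c a
  have hne : (PowerSeries.C a * PowerSeries.X : PowerSeries K) ≠ 0 :=
    mul_ne_zero (by simpa using ha) PowerSeries.X_ne_zero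
  have hinj := IsFractionRing.injective (PowerSeries K) (FractionRing (PowerSeries K))
  have h1 := congrArg (algebraMap (PowerSeries K) (FractionRing (PowerSeries K))) h
  have hne' : algebraMap (PowerSeries K) (FractionRing (PowerSeries K))
      (PowerSeries.C a * PowerSeries.X) ≠ 0 := by
    rw [Ne, map_eq_zero_iff _ hinj]
    exact hne
  rw [map_mul, map_sub, map_one, map_mul] at h1
  rw [← h1] at hne' ⊢
  rw [div_mul_cancel_left₀ (left_ne_zero_of_mul hne')]

/-- The character `u ↦ exp (-(u ⬝ᵥ y) t)` of `ℤⁿ`. -/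
def expChar {n : ℕ} (y : Fin n → K) :
    Multiplicative (Fin n → ℤ) →* FractionRing (PowerSeries K) where
  toFun u := algebraMap (PowerSeries K) _ (expNeg (∑ i, (u.toAdd i : K) * y i))
  map_one' := by simp [expNeg_zero]
  map_mul' u v := by
    rw [← map_mul, ← expNeg_add, ← Finset.sum_add_distrib]
    simp [add_mul]

theorem expChar_ofAdd {n : ℕ} (y : Fin n → K) (u : Fin n → ℤ) :
    expChar y (Multiplicative.ofAdd u) =
      algebraMap (PowerSeries K) _ (expNeg (∑ i, (u i : K) * y i)) := rfl

theorem expChar_ne_one {n : ℕ} {y : Fin n → K} {u : Fin n → ℤ}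
    (h : ∑ i, (u i : K) * y i ≠ 0) : expChar y (Multiplicative.ofAdd u) ≠ 1 := by
  rw [expChar_ofAdd, Ne, map_eq_one_iff _ (IsFractionRing.injective _ _)]
  exact expNeg_ne_one h

end Line

/-! ### Todd polynomials of simplicial and of unimodular cones -/

section Comparison

theorem eval₂_toddPoly {K : Type*} [Field K] {n : ℕ} (C : SimplicialCone n) (φ : ℂ →+* K) (x : Fin n → K) (N : ℕ) :
    MvPolynomial.eval₂ φ x (C.toddPoly N) = PowerSeries.coeff N (∑ γ : C.Gamma, ∏ j,
      PowerSeries.rescale (x j) (PowerSeries.map φ (toddFactor (C.char j γ)))) := by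
  rw [SimplicialCone.toddPoly, SimplicialCone.todd, homogPart_sum, MvPolynomial.eval₂_sum, map_sum]
  exact Finset.sum_congr rfl fun γ _ => eval₂_homogPart φ _ x N

variable {K : Type*} [Field K] [Algebra ℚ K]

theorem prod_inv_one_sub_eq {F : Type*} [Field F] [Algebra ℚ F] (φ : F →+* K) {n : ℕ}
    (c : Fin n → F) {a : Fin n → K} (ha : ∀ j, a j ≠ 0) :
    ∏ j, (1 - algebraMap (PowerSeries K) (FractionRing (PowerSeries K)) (PowerSeries.C (φ (c j))) *
      algebraMap (PowerSeries K) (FractionRing (PowerSeries K)) (expNeg (a j)))⁻¹ =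
    algebraMap (PowerSeries K) (FractionRing (PowerSeries K)) (PowerSeries.C (∏ j, a j)⁻¹ *
      ∏ j, PowerSeries.rescale (a j) (PowerSeries.map φ (toddFactor (c j)))) /
    algebraMap (PowerSeries K) (FractionRing (PowerSeries K)) PowerSeries.X ^ n := by
  have h : ∀ j, (1 - algebraMap (PowerSeries K) (FractionRing (PowerSeries K))
      (PowerSeries.C (φ (c j))) *
      algebraMap (PowerSeries K) (FractionRing (PowerSeries K)) (expNeg (a j)))⁻¹ =
      algebraMap (PowerSeries K) (FractionRing (PowerSeries K)) (PowerSeries.C (a j)⁻¹ *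
        PowerSeries.rescale (a j) (PowerSeries.map φ (toddFactor (c j)))) /
      algebraMap (PowerSeries K) (FractionRing (PowerSeries K)) PowerSeries.X := by
    intro j
    have h1 : algebraMap (PowerSeries K) (FractionRing (PowerSeries K)) (PowerSeries.C (a j)⁻¹) =
        (algebraMap (PowerSeries K) (FractionRing (PowerSeries K)) (PowerSeries.C (a j)))⁻¹ := by
      refine eq_inv_of_mul_eq_one_left ?_
      rw [← map_mul, ← map_mul, inv_mul_cancel₀ (ha j), map_one, map_one]
    rw [inv_one_sub_eq φ (c j) (ha j), map_mul, map_mul, h1]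
    ring
  simp only [h, Finset.prod_div_distrib, ← map_prod, ← map_pow, Finset.prod_const, Finset.card_univ,
    Fintype.card_fin, Finset.prod_mul_distrib, Finset.prod_inv_distrib]

/-- The Todd polynomial of a simplicial cone in terms of those of unimodular cones. -/
theorem exists_eval₂_toddPoly_eq {n : ℕ} (C : SimplicialCone n) (φ : ℂ →+* K) (x : Fin n → K)
    (hx : ∀ u : Fin n → ℤ, u ≠ 0 → ∑ i, ((C.gen i ⬝ᵥ u : ℤ) : K) * x i ≠ 0) (N : ℕ) :
    ∃ l : List (Matrix (Fin n) (Fin n) ℤ), (∀ A ∈ l, A.det.natAbs = C.M.det.natAbs) ∧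
      MvPolynomial.eval₂ φ x (C.toddPoly N) = (C.M.det.natAbs : K) * (∏ i, x i) *
        (l.map fun A => MvPolynomial.eval₂ (algebraMap ℚ K) (fun j => ∑ i, (A j i : K) * x i)
          (homogPart (stdTodd n) N) / ∏ j, ∑ i, (A j i : K) * x i).sum := by
  set V : Matrix (Fin n) (Fin n) ℤ := Matrix.of C.gen with hVdef
  have hV : V.det ≠ 0 := by
    rw [hVdef, SimplicialCone.det_of_gen]
    exact C.det_ne_zero
  have hcard : Fintype.card C.Gamma = V.det.natAbs := by
    rw [C.card_Gamma, hVdef, SimplicialCone.det_of_gen]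
  have hcard0 : (0 : ℤ) < Fintype.card C.Gamma := by
    rw [hcard]
    positivity
  -- The point ∑ x_i v_i; pairing it with `u` gives the linear form in x with coefficients v_i·u.
  let y : Fin n → K := fun k => ∑ i, (C.gen i k : K) * x i
  have hy : ∀ u : Fin n → ℤ, ∑ k, (u k : K) * y k = ∑ i, ((C.gen i ⬝ᵥ u : ℤ) : K) * x i := by
    intro u
    simp only [y, dotProduct, Finset.mul_sum, Int.cast_sum, Int.cast_mul, Finset.sum_mul]
    rw [Finset.sum_comm]
    refine Finset.sum_congr rfl fun i _ => Finset.sum_congr rfl fun k _ => by ring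
  have hz : ∀ u : Fin n → ℤ, u ≠ 0 → expChar y (Multiplicative.ofAdd u) ≠ 1 := by
    intro u hu
    refine expChar_ne_one ?_
    rw [hy]
    exact hx u hu
  obtain ⟨l, hl1, hl2⟩ := exists_unimodular_decomposition V hV
  choose u hu using fun W : Matrix (Fin n) (Fin n) ℤ => exists_dual_vectors W
  have hl0 : ∀ W ∈ l, W.det ≠ 0 := by
    intro W hW h0
    have := hl1 W hW
    simp [h0] at this
  have hu1 : ∀ W ∈ l, ∀ i j, W i ⬝ᵥ u W j = if i = j then 1 else 0 := by
    intro W hW i j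
    rw [hu, hl1 W hW, Nat.cast_one]
  have huV : ∀ i j, C.gen i ⬝ᵥ u V j = if i = j then (Fintype.card C.Gamma : ℤ) else 0 := by
    intro i j
    rw [hcard]
    exact hu V i j
  have hne : ∀ W ∈ l, ∀ j, u W j ≠ 0 := by
    intro W hW j h0
    have := hu1 W hW j j
    simp [h0] at this
  have hx0 : ∀ j, x j ≠ 0 := by
    intro j h0
    have huVj : u V j ≠ 0 := by
      intro h
      have := huV j j
      rw [h, dotProduct_zero, if_pos rfl] at this
      exact hcard0.ne this
    refine hx _ huVj ?_
    simp [huV, h0]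
  let A : Matrix (Fin n) (Fin n) ℤ → Matrix (Fin n) (Fin n) ℤ :=
    fun W => Matrix.of fun j i => C.gen i ⬝ᵥ u W j
  have hAy : ∀ W j, ∑ k, (u W j k : K) * y k = ∑ i, (A W j i : K) * x i := fun W j => hy _
  have hA0 : ∀ W ∈ l, ∀ j, ∑ i, (A W j i : K) * x i ≠ 0 := fun W hW j => hx _ (hne W hW j)
  -- `A W` is the matrix of dual vectors of `W`, which is unimodular, times M_C.
  have hdet : ∀ W ∈ l, (A W).det.natAbs = C.M.det.natAbs := by
    intro W hW
    have h1 : A W = Matrix.of (u W) * C.M := by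
      ext j i
      simp only [A, of_apply, Matrix.mul_apply, dotProduct, SimplicialCone.M]
      exact Finset.sum_congr rfl fun k _ => mul_comm _ _
    have h2 : W * (Matrix.of (u W))ᵀ = 1 := by
      ext i j
      rw [Matrix.one_apply, ← hu1 W hW]
      rfl
    have h3 := congrArg (fun B => B.det.natAbs) h2
    simp only [det_mul, det_transpose, Int.natAbs_mul, det_one, hl1 W hW, one_mul,
      Int.natAbs_one] at h3
    rw [h1, det_mul, Int.natAbs_mul, h3, one_mul]
  obtain ⟨B, hB⟩ := SimplicialCone.exists_box_finset hV (Fintype.card C.Gamma)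
  have hzV : ∀ m, expChar y (Multiplicative.ofAdd m) =
      algebraMap (PowerSeries K) _ (expNeg (∑ i, ((C.gen i ⬝ᵥ m : ℤ) : K) * x i)) := by
    intro m
    rw [expChar_ofAdd, hy]
  have hzu : ∀ j, expChar y (Multiplicative.ofAdd (u V j)) =
      algebraMap (PowerSeries K) (FractionRing (PowerSeries K)) (expNeg (x j)) ^
        Fintype.card C.Gamma := by
    intro j
    rw [hzV, ← map_pow, ← expNeg_natCast_mul]
    simp [huV]
  have hzu1 : ∀ j, expChar y (Multiplicative.ofAdd (u V j)) ≠ 1 := by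
    intro j
    refine hz _ fun h => ?_
    have := huV j j
    rw [h, dotProduct_zero, if_pos rfl] at this
    exact hcard0.ne this
  have hzB : ∀ m ∈ B, expChar y (Multiplicative.ofAdd m) =
      ∏ j, algebraMap (PowerSeries K) (FractionRing (PowerSeries K)) (expNeg (x j)) ^
        (C.gen j ⬝ᵥ m).toNat := by
    intro m hm
    rw [hzV, expNeg_sum, map_prod]
    refine Finset.prod_congr rfl fun j _ => ?_
    rw [← map_pow, ← expNeg_natCast_mul]
    have h1 : ((C.gen j ⬝ᵥ m).toNat : ℤ) = C.gen j ⬝ᵥ m := Int.toNat_of_nonneg ((hB m).1 hm j).1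
    rw [← Int.cast_natCast (R := K), h1]
  have hgen1 := hasGenSum_coneFn hcard0 huV hzu1 hB
  have hgen2 : HasGenSum (expChar y) (l.map coneFn).sum
      (l.map fun W => (∏ j, (1 - expChar y (Multiplicative.ofAdd (u W j))))⁻¹).sum :=
    HasGenSum.list_sum fun W hW => hasGenSum_coneFn_of_unimodular hz (hl0 W hW) (hu1 W hW)
  have hgen3 := (hasGenSum_of_mem_negligible hz hl2).add hgen2
  rw [sub_add_cancel, zero_add] at hgen3
  -- The box formula and the unimodular decomposition compute the same generating function.
  have hsum := hgen1.unique hgen3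
  have hchar := C.sum_prod_inv_one_sub
    ((algebraMap (PowerSeries K) (FractionRing (PowerSeries K))).comp (PowerSeries.C.comp φ))
    (fun j => algebraMap (PowerSeries K) (FractionRing (PowerSeries K)) (expNeg (x j)))
    (fun j => by rw [← hzu]; exact hzu1 j) hB
  rw [← Finset.sum_congr rfl hzB, ← Finset.prod_congr rfl fun j _ => congrArg (1 - ·) (hzu j),
    hsum] at hchar
  have hleft : ∀ γ, ∏ j, (1 - ((algebraMap (PowerSeries K) (FractionRing (PowerSeries K))).comp
      (PowerSeries.C.comp φ)) (C.char j γ) * algebraMap (PowerSeries K)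
        (FractionRing (PowerSeries K)) (expNeg (x j)))⁻¹ = _ :=
    fun γ => prod_inv_one_sub_eq φ (fun j => C.char j γ) hx0
  let T : Matrix (Fin n) (Fin n) ℤ → PowerSeries K := fun W =>
    PowerSeries.C (∏ j, ∑ i, (A W j i : K) * x i)⁻¹ * ∏ j, PowerSeries.rescale
      (∑ i, (A W j i : K) * x i) (PowerSeries.map (algebraMap ℚ K) (toddFactor 1))
  have hright : ∀ W ∈ l, (∏ j, (1 - expChar y (Multiplicative.ofAdd (u W j))))⁻¹ =
      algebraMap (PowerSeries K) (FractionRing (PowerSeries K)) (T W) *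
        (algebraMap (PowerSeries K) (FractionRing (PowerSeries K)) PowerSeries.X ^ n)⁻¹ := by
    intro W hW
    have := prod_inv_one_sub_eq (algebraMap ℚ K) (fun _ => 1) (hA0 W hW)
    simp only [map_one, one_mul] at this
    rw [← Finset.prod_inv_distrib, ← div_eq_mul_inv, ← this]
    simp only [expChar_ofAdd, hAy]
  rw [Finset.sum_congr rfl fun γ _ => hleft γ, List.map_congr_left hright, ← Finset.sum_div,
    List.sum_map_mul_right, ← mul_assoc, ← div_eq_mul_inv] at hchar
  have hinj := IsFractionRing.injective (PowerSeries K) (FractionRing (PowerSeries K))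
  have hX : algebraMap (PowerSeries K) (FractionRing (PowerSeries K)) PowerSeries.X ^ n ≠ 0 :=
    pow_ne_zero _ ((map_ne_zero_iff _ hinj).2 PowerSeries.X_ne_zero)
  -- Both sides carry the same pole factor t^{-n}; removing it leaves an identity of power series.
  have hps : ∑ γ : C.Gamma, PowerSeries.C (∏ j, x j)⁻¹ * ∏ j, PowerSeries.rescale (x j)
      (PowerSeries.map φ (toddFactor (C.char j γ))) =
      PowerSeries.C (Fintype.card C.Gamma : K) * (l.map T).sum := by
    apply hinj
    rw [map_sum, (div_left_inj' hX).1 hchar, map_mul, map_list_sum, List.map_map, map_natCast,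
      map_natCast]
    rfl
  have hcoeff := congrArg (PowerSeries.coeff N) hps
  rw [← Finset.mul_sum, PowerSeries.coeff_C_mul, PowerSeries.coeff_C_mul, ← eval₂_toddPoly,
    map_list_sum, List.map_map, C.card_Gamma, inv_mul_eq_iff_eq_mul₀
      (Finset.prod_ne_zero_iff.2 fun j _ => hx0 j)] at hcoeff
  refine ⟨l.map A, ?_, ?_⟩
  · intro A' hA'
    obtain ⟨W, hW, rfl⟩ := List.mem_map.1 hA'
    exact hdet W hW
  · rw [hcoeff, List.map_map, ← mul_assoc, mul_comm (∏ i, x i)]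
    congr 2
    refine List.map_congr_left fun W _ => ?_
    simp only [Function.comp_apply, T, PowerSeries.coeff_C_mul, stdTodd]
    rw [eval₂_homogPart, div_eq_inv_mul]

end Comparison

/-! ### Primitive polynomials and integrality -/

section Gauss

variable {n : ℕ}

/-- A polynomial with integer coefficients is primitive if no prime divides it. -/
def IsPrim (F : MvPolynomial (Fin n) ℤ) : Prop := ∀ p : ℤ, Prime p → ¬ MvPolynomial.C p ∣ F

theorem isPrim_one : IsPrim (1 : MvPolynomial (Fin n) ℤ) := fun _ hp h =>
  ((MvPolynomial.prime_C_iff (Fin n)).2 hp).not_isUnit (isUnit_of_dvd_one h)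

/-- A prime of ℤ remains prime in ℤ[x]. -/
theorem IsPrim.mul {F G : MvPolynomial (Fin n) ℤ} (hF : IsPrim F) (hG : IsPrim G) :
    IsPrim (F * G) := fun p hp h =>
  (((MvPolynomial.prime_C_iff (Fin n)).2 hp).dvd_or_dvd h).elim (hF p hp) (hG p hp)

theorem isPrim_prod {ι : Type*} (s : Finset ι) {F : ι → MvPolynomial (Fin n) ℤ}
    (h : ∀ i ∈ s, IsPrim (F i)) : IsPrim (∏ i ∈ s, F i) :=
  Finset.prod_induction F IsPrim (fun _ _ => IsPrim.mul) isPrim_one h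

theorem IsPrim.ne_zero {F : MvPolynomial (Fin n) ℤ} (hF : IsPrim F) : F ≠ 0 := by
  rintro rfl
  exact hF 2 Int.prime_two (dvd_zero _)

/-- The prime factors of `D` are moved one at a time into `G`, since none of them divides `F`. -/
theorem IsPrim.C_dvd_of_C_dvd_mul {F : MvPolynomial (Fin n) ℤ} (hF : IsPrim F) {D : ℤ}
    (hD : D ≠ 0) {G : MvPolynomial (Fin n) ℤ} (h : MvPolynomial.C D ∣ G * F) :
    MvPolynomial.C D ∣ G := by
  induction D using UniqueFactorizationMonoid.induction_on_prime generalizing G with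
  | h₁ => exact absurd rfl hD
  | h₂ a ha => exact (ha.map MvPolynomial.C).dvd
  | h₃ a p ha hp ih =>
    have hpC : Prime (MvPolynomial.C p : MvPolynomial (Fin n) ℤ) :=
      (MvPolynomial.prime_C_iff (Fin n)).2 hp
    rw [map_mul] at h ⊢
    obtain ⟨G', rfl⟩ := (hpC.dvd_or_dvd ((dvd_mul_right _ _).trans h)).resolve_right (hF p hp)
    rw [mul_assoc, mul_dvd_mul_iff_left hpC.ne_zero] at h
    exact mul_dvd_mul_left _ (ih ha h)

theorem exists_C_mul_eq_map (G : MvPolynomial (Fin n) ℚ) :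
    ∃ D : ℤ, D ≠ 0 ∧ ∃ G' : MvPolynomial (Fin n) ℤ,
      MvPolynomial.C (D : ℚ) * G = MvPolynomial.map (Int.castRingHom ℚ) G' := by
  induction G using MvPolynomial.induction_on' with
  | monomial r a =>
    refine ⟨a.den, by exact_mod_cast a.den_ne_zero, MvPolynomial.monomial r a.num, ?_⟩
    rw [MvPolynomial.C_mul_monomial, MvPolynomial.map_monomial, Int.cast_natCast,
      Rat.den_mul_eq_num]
    rfl
  | add G H hG hH =>
    obtain ⟨D, hD, G', hG'⟩ := hG
    obtain ⟨E, hE, H', hH'⟩ := hH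
    refine ⟨D * E, mul_ne_zero hD hE, MvPolynomial.C E * G' + MvPolynomial.C D * H', ?_⟩
    rw [map_add, map_mul, map_mul, ← hG', ← hH', MvPolynomial.map_C, MvPolynomial.map_C]
    simp only [Int.cast_mul, map_mul, eq_intCast]
    ring

theorem map_intCast_injective {F : Type*} [Field F] [CharZero F] :
    Function.Injective (MvPolynomial.map (σ := Fin n) (Int.castRingHom F)) :=
  MvPolynomial.map_injective _ (RingHom.injective_int _)

/-- Gauss's lemma: the quotient of an integral polynomial by a primitive one is integral as soon
as it is a polynomial. -/
theorem IsPrim.exists_eq_map_of_mul_eq {F P : MvPolynomial (Fin n) ℤ} (hF : IsPrim F)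
    {G : MvPolynomial (Fin n) ℂ}
    (h : G * MvPolynomial.map (Int.castRingHom ℂ) F = MvPolynomial.map (Int.castRingHom ℂ) P) :
    ∃ G' : MvPolynomial (Fin n) ℤ, G = MvPolynomial.map (Int.castRingHom ℂ) G' := by
  -- A ℚ-linear retraction ℂ → ℚ, applied to all coefficients, turns the complex quotient into a
  -- rational one; by uniqueness of the quotient the two agree.
  obtain ⟨π, hπ⟩ := LinearMap.exists_leftInverse_of_injective
    (Algebra.linearMap ℚ ℂ) (LinearMap.ker_eq_bot.2 (algebraMap ℚ ℂ).injective)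
  have hπ1 : ∀ a : ℤ, π (a : ℂ) = a := by
    intro a
    have := LinearMap.congr_fun hπ (a : ℚ)
    simpa using this
  have hFC : MvPolynomial.map (Int.castRingHom ℂ) F ≠ 0 :=
    (map_ne_zero_iff _ map_intCast_injective).2 hF.ne_zero
  let G1 : MvPolynomial (Fin n) ℚ :=
    ∑ r ∈ G.support, MvPolynomial.monomial r (π (MvPolynomial.coeff r G))
  have hG1 : ∀ r, MvPolynomial.coeff r G1 = π (MvPolynomial.coeff r G) := by
    intro r
    simp only [G1, MvPolynomial.coeff_sum, MvPolynomial.coeff_monomial, Finset.sum_ite_eq']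
    split_ifs with hr
    · rfl
    · rw [MvPolynomial.notMem_support_iff.1 hr, map_zero]
  have h1 : G1 * MvPolynomial.map (Int.castRingHom ℚ) F =
      MvPolynomial.map (Int.castRingHom ℚ) P := by
    ext r
    have := congrArg (fun f => π (MvPolynomial.coeff r f)) h
    simp only [MvPolynomial.coeff_mul, MvPolynomial.coeff_map, map_sum, eq_intCast, hπ1] at this
    rw [MvPolynomial.coeff_mul, MvPolynomial.coeff_map, eq_intCast, ← this]
    refine Finset.sum_congr rfl fun s _ => ?_
    rw [MvPolynomial.coeff_map, eq_intCast, hG1, mul_comm, mul_comm (MvPolynomial.coeff s.1 G),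
      ← zsmul_eq_mul, ← zsmul_eq_mul, map_zsmul]
  have hmap : ∀ f : MvPolynomial (Fin n) ℤ, MvPolynomial.map (algebraMap ℚ ℂ)
      (MvPolynomial.map (Int.castRingHom ℚ) f) = MvPolynomial.map (Int.castRingHom ℂ) f := by
    intro f
    rw [MvPolynomial.map_map]
    congr 1
  have h2 : G = MvPolynomial.map (algebraMap ℚ ℂ) G1 := by
    have := congrArg (MvPolynomial.map (algebraMap ℚ ℂ)) h1
    rw [map_mul, hmap, hmap, ← h] at this
    exact (mul_right_cancel₀ hFC this).symm
  obtain ⟨D, hD, G2, hG2⟩ := exists_C_mul_eq_map G1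
  have h3 : G2 * F = MvPolynomial.C D * P := by
    apply map_intCast_injective (F := ℚ)
    rw [map_mul, map_mul, ← hG2, mul_assoc, h1, MvPolynomial.map_C]
    rfl
  obtain ⟨G3, rfl⟩ := hF.C_dvd_of_C_dvd_mul hD ⟨P, h3⟩
  refine ⟨G3, ?_⟩
  rw [h2, ← hmap]
  congr 1
  rw [map_mul, MvPolynomial.map_C] at hG2
  refine mul_left_cancel₀ ?_ hG2
  rw [Ne, MvPolynomial.C_eq_zero]
  exact_mod_cast hD

/-- The embedding of `ℤ[x]` in `ℂ(x)`. -/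
def intEmb (n : ℕ) : MvPolynomial (Fin n) ℤ →+* FractionRing (MvPolynomial (Fin n) ℂ) :=
  (algebraMap (MvPolynomial (Fin n) ℂ) _).comp (MvPolynomial.map (Int.castRingHom ℂ))

theorem intEmb_injective (n : ℕ) : Function.Injective (intEmb n) :=
  (IsFractionRing.injective (MvPolynomial (Fin n) ℂ) _).comp map_intCast_injective

/-- Quotients of an integral polynomial by a primitive one. -/
def IsIntegralQuotient (k : FractionRing (MvPolynomial (Fin n) ℂ)) : Prop :=
  ∃ P F : MvPolynomial (Fin n) ℤ, IsPrim F ∧ k * intEmb n F = intEmb n P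

theorem IsIntegralQuotient.add {k l : FractionRing (MvPolynomial (Fin n) ℂ)}
    (hk : IsIntegralQuotient k) (hl : IsIntegralQuotient l) : IsIntegralQuotient (k + l) := by
  obtain ⟨P, F, hF, h⟩ := hk
  obtain ⟨P', F', hF', h'⟩ := hl
  refine ⟨P * F' + P' * F, F * F', hF.mul hF', ?_⟩
  rw [map_add, map_mul, map_mul, map_mul, ← h, ← h']
  ring

theorem isIntegralQuotient_list_sum {l : List (FractionRing (MvPolynomial (Fin n) ℂ))}
    (h : ∀ k ∈ l, IsIntegralQuotient k) : IsIntegralQuotient l.sum := by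
  induction l with
  | nil => exact ⟨0, 1, isPrim_one, by simp⟩
  | cons k l ih =>
    rw [List.sum_cons]
    exact (h k List.mem_cons_self).add (ih fun j hj => h j (List.mem_cons_of_mem k hj))

theorem IsIntegralQuotient.exists_eq_map {G : MvPolynomial (Fin n) ℂ}
    (h : IsIntegralQuotient (algebraMap _ (FractionRing (MvPolynomial (Fin n) ℂ)) G)) :
    ∃ P : MvPolynomial (Fin n) ℤ, G = MvPolynomial.map (Int.castRingHom ℂ) P := by
  obtain ⟨P, F, hF, h⟩ := h
  refine hF.exists_eq_map_of_mul_eq (P := P)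
    (IsFractionRing.injective (MvPolynomial (Fin n) ℂ) (FractionRing (MvPolynomial (Fin n) ℂ)) ?_)
  rw [map_mul]
  exact h

/-- The linear form with coefficients `a`. -/
def linForm {R : Type*} [CommRing R] (a : Fin n → R) : MvPolynomial (Fin n) R :=
  ∑ i, MvPolynomial.C (a i) * MvPolynomial.X i

theorem coeff_linForm {R : Type*} [CommRing R] (a : Fin n → R) (i : Fin n) :
    MvPolynomial.coeff (Finsupp.single i 1) (linForm a) = a i := by
  classical
  simp [linForm, MvPolynomial.coeff_sum, MvPolynomial.coeff_C_mul, MvPolynomial.coeff_X,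
    Finsupp.single_left_inj]

/-- The constant `c` is the content, the gcd of the coefficients. -/
theorem exists_linForm_eq (a : Fin n → ℤ) (ha : a ≠ 0) :
    ∃ (c : ℤ) (b : Fin n → ℤ), a = c • b ∧ IsPrim (linForm b) := by
  have hne : (Finset.univ : Finset (Fin n)).Nonempty := by
    by_contra h
    rw [Finset.not_nonempty_iff_eq_empty, Finset.univ_eq_empty_iff] at h
    exact ha (Subsingleton.elim _ _)
  obtain ⟨b, hb, hb1⟩ := Finset.extract_gcd a hne
  refine ⟨Finset.univ.gcd a, b, funext fun i => hb i (Finset.mem_univ i), fun p hp h => ?_⟩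
  refine hp.not_isUnit (isUnit_of_dvd_one ?_)
  rw [← hb1]
  refine Finset.dvd_gcd fun i _ => ?_
  rw [← coeff_linForm b i]
  exact (MvPolynomial.C_dvd_iff_dvd_coeff _ _).1 h _

theorem linForm_smul (c : ℤ) (b : Fin n → ℤ) :
    linForm (c • b) = MvPolynomial.C c * linForm b := by
  simp [linForm, Finset.mul_sum, mul_assoc]

/-- Dividing by the row forms of a nonsingular integer matrix costs at most its determinant, which
is divisible by the product of the contents of the rows. -/
theorem isIntegralQuotient_div_prod_linForm {A : Matrix (Fin n) (Fin n) ℤ} (hA : A.det ≠ 0)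
    (P : MvPolynomial (Fin n) ℤ) :
    IsIntegralQuotient ((A.det.natAbs : FractionRing (MvPolynomial (Fin n) ℂ)) *
      intEmb n P / ∏ j, intEmb n (linForm (A j))) := by
  have hrow : ∀ j, A j ≠ 0 := fun j h => hA (det_eq_zero_of_row_eq_zero j (congrFun h))
  choose c b hcb hb using fun j => exists_linForm_eq (A j) (hrow j)
  -- Extracting the contents of the rows factors `A` as a diagonal matrix times an integer matrix.
  have hdet : A.det = (∏ j, c j) * (Matrix.of b).det := by
    have : A = Matrix.diagonal c * Matrix.of b := by
      ext j i
      rw [diagonal_mul, congrFun (hcb j) i]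
      rfl
    conv_lhs => rw [this]
    rw [det_mul, det_diagonal]
  have hc : ∏ j, c j ≠ 0 := left_ne_zero_of_mul (hdet ▸ hA)
  obtain ⟨e, he⟩ : (∏ j, c j) ∣ (A.det.natAbs : ℤ) := Int.dvd_natAbs.2 ⟨_, hdet⟩
  have hprim : IsPrim (∏ j, linForm (b j)) := isPrim_prod _ fun j _ => hb j
  have hprod : ∏ j, intEmb n (linForm (A j)) =
      intEmb n (MvPolynomial.C (∏ j, c j)) * intEmb n (∏ j, linForm (b j)) := by
    rw [← map_prod, ← map_mul, map_prod MvPolynomial.C, ← Finset.prod_mul_distrib]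
    congr 1
    refine Finset.prod_congr rfl fun j _ => ?_
    rw [← linForm_smul, ← hcb]
  have h1 : intEmb n (MvPolynomial.C (∏ j, c j)) ≠ 0 :=
    (map_ne_zero_iff _ (intEmb_injective n)).2 (by simpa [Finset.prod_eq_zero_iff] using hc)
  have h2 : intEmb n (∏ j, linForm (b j)) ≠ 0 :=
    (map_ne_zero_iff _ (intEmb_injective n)).2 hprim.ne_zero
  have h3 : (A.det.natAbs : FractionRing (MvPolynomial (Fin n) ℂ)) =
      intEmb n (MvPolynomial.C (∏ j, c j)) * intEmb n (MvPolynomial.C e) := by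
    rw [← map_mul, ← map_mul, ← he]
    simp
  refine ⟨MvPolynomial.C e * P, _, hprim, ?_⟩
  rw [hprod, h3, map_mul]
  field_simp

end Gauss

/-! ### The Todd polynomials of a cone -/

section Main

variable {n : ℕ}

theorem toddDenom_ne_zero (N n : ℕ) : toddDenom N n ≠ 0 := by
  rw [toddDenom, Ne, Finset.lcm_eq_zero_iff]
  rintro ⟨r, _, h⟩
  exact Rat.den_ne_zero _ h

theorem exists_toddDenom_mul_homogPart_eq (N n : ℕ) : ∃ H : MvPolynomial (Fin n) ℤ,
    MvPolynomial.map (Int.castRingHom ℚ) H =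
      MvPolynomial.C (toddDenom N n : ℚ) * homogPart (stdTodd n) N := by
  have h : ∀ r ∈ (homogPart (stdTodd n) N).support, ∃ k : ℤ,
      (k : ℚ) = toddDenom N n * MvPolynomial.coeff r (homogPart (stdTodd n) N) := by
    intro r hr
    obtain ⟨e, he⟩ : (MvPolynomial.coeff r (homogPart (stdTodd n) N)).den ∣ toddDenom N n :=
      Finset.dvd_lcm hr
    refine ⟨e * (MvPolynomial.coeff r (homogPart (stdTodd n) N)).num, ?_⟩
    rw [he]
    push_cast
    rw [← Rat.den_mul_eq_num]
    ring
  choose! k hk using h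
  refine ⟨∑ r ∈ (homogPart (stdTodd n) N).support, MvPolynomial.monomial r (k r), ?_⟩
  conv_rhs => rw [MvPolynomial.as_sum (homogPart (stdTodd n) N), Finset.mul_sum]
  rw [map_sum]
  refine Finset.sum_congr rfl fun r hr => ?_
  rw [MvPolynomial.map_monomial, MvPolynomial.C_mul_monomial, eq_intCast, hk r hr]

theorem intEmb_linForm (a : Fin n → ℤ) :
    intEmb n (linForm a) = ∑ i, (a i : FractionRing (MvPolynomial (Fin n) ℂ)) *
      algebraMap (MvPolynomial (Fin n) ℂ) _ (MvPolynomial.X i) := by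
  simp [intEmb, linForm]

/-- The Todd polynomials of a simplicial cone have denominators dividing `d_{N,n}`. -/
theorem exists_toddPoly_eq (C : SimplicialCone n) (N : ℕ) :
    ∃ P : MvPolynomial (Fin n) ℤ, C.toddPoly N =
      MvPolynomial.C (1 / (toddDenom N n : ℂ)) * MvPolynomial.map (Int.castRingHom ℂ) P := by
  let K := FractionRing (MvPolynomial (Fin n) ℂ)
  let ι : MvPolynomial (Fin n) ℂ →+* K := algebraMap (MvPolynomial (Fin n) ℂ) K
  let x : Fin n → K := fun i => ι (MvPolynomial.X i)
  -- The variables of ℂ(x) form a generic point: a vanishing linear form has zero coefficients, so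
  -- `u` is orthogonal to all generators and hence zero.
  have hx : ∀ u : Fin n → ℤ, u ≠ 0 → ∑ i, ((C.gen i ⬝ᵥ u : ℤ) : K) * x i ≠ 0 := by
    intro u hu h0
    have h1 : intEmb n (linForm fun i => C.gen i ⬝ᵥ u) = 0 := (intEmb_linForm _).trans h0
    rw [map_eq_zero_iff _ (intEmb_injective n)] at h1
    refine hu (eq_of_forall_dotProduct_eq (V := Matrix.of C.gen)
      (by rw [SimplicialCone.det_of_gen]; exact C.det_ne_zero) fun i => ?_)
    have h2 := coeff_linForm (fun i => C.gen i ⬝ᵥ u) i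
    rw [h1, MvPolynomial.coeff_zero] at h2
    rw [dotProduct_zero]
    exact h2.symm
  obtain ⟨l, hl, h⟩ := exists_eval₂_toddPoly_eq C (ι.comp MvPolynomial.C) x hx N
  have heval : MvPolynomial.eval₂ (ι.comp MvPolynomial.C) x (C.toddPoly N) = ι (C.toddPoly N) := by
    have : MvPolynomial.eval₂Hom (ι.comp MvPolynomial.C) x = ι :=
      MvPolynomial.ringHom_ext (by simp) (by simp [x])
    exact RingHom.congr_fun this _
  obtain ⟨H, hH⟩ := exists_toddDenom_mul_homogPart_eq N n
  have hHA : ∀ A : Matrix (Fin n) (Fin n) ℤ, (toddDenom N n : K) *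
      MvPolynomial.eval₂ (algebraMap ℚ K) (fun j => ∑ i, (A j i : K) * x i)
        (homogPart (stdTodd n) N) =
      intEmb n (MvPolynomial.aeval (fun j => linForm (A j)) H) := by
    intro A
    have h1 := congrArg (MvPolynomial.eval₂ (algebraMap ℚ K) fun j => ∑ i, (A j i : K) * x i) hH
    rw [MvPolynomial.eval₂_mul, MvPolynomial.eval₂_C, map_natCast, MvPolynomial.eval₂_map] at h1
    rw [← h1, MvPolynomial.aeval_def, MvPolynomial.eval₂_comp_left]
    congr 1
    · exact RingHom.ext_int _ _
    · funext j
      exact (intEmb_linForm (A j)).symm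
  have hint : IsIntegralQuotient (ι (MvPolynomial.C (toddDenom N n : ℂ) * C.toddPoly N)) := by
    have h1 : ι (MvPolynomial.C (toddDenom N n : ℂ) * C.toddPoly N) =
        (l.map fun A => (A.det.natAbs : K) * intEmb n ((∏ i, MvPolynomial.X i) *
          MvPolynomial.aeval (fun j => linForm (A j)) H) /
          ∏ j, intEmb n (linForm (A j))).sum := by
      have h2 : ι (MvPolynomial.C (toddDenom N n : ℂ)) = (toddDenom N n : K) := by simp
      rw [map_mul, ← heval, h, h2, ← mul_assoc, ← List.sum_map_mul_left]
      congr 1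
      refine List.map_congr_left fun A hA => ?_
      have h3 : intEmb n (∏ i, MvPolynomial.X i) = ∏ i, x i := by simp [intEmb, x, ι, K]
      have h4 : ∀ j, ∑ i, (A j i : K) * x i = intEmb n (linForm (A j)) :=
        fun j => (intEmb_linForm (A j)).symm
      rw [hl A hA, map_mul, ← hHA, h3]
      simp only [h4]
      ring
    rw [h1]
    refine isIntegralQuotient_list_sum fun k hk => ?_
    obtain ⟨A, hA, rfl⟩ := List.mem_map.1 hk
    refine isIntegralQuotient_div_prod_linForm (fun h0 => ?_) _
    have := hl A hA
    rw [h0, Int.natAbs_zero, eq_comm, Int.natAbs_eq_zero] at this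
    exact C.det_ne_zero this
  obtain ⟨P, hP⟩ := hint.exists_eq_map
  refine ⟨P, ?_⟩
  rw [← hP, ← mul_assoc, ← map_mul, one_div, inv_mul_cancel₀
    (Nat.cast_ne_zero.2 (toddDenom_ne_zero N n)), map_one, one_mul]

namespace SimplicialCone

variable (C : SimplicialCone n)

theorem polyInBasis_dualGen (i : Fin n) : C.polyInBasis (C.dualGen i) = MvPolynomial.X i := by
  have h : C.MC⁻¹ * C.MC = 1 :=
    Matrix.nonsing_inv_mul _ (isUnit_iff_ne_zero.mpr C.det_MC_ne_zero)
  have h2 : ∀ l, ∑ k, C.MC⁻¹ i k * ((C.gen l k : ℤ) : ℂ) = if i = l then 1 else 0 := by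
    intro l
    have := congrFun (congrFun h i) l
    rw [Matrix.one_apply, Matrix.mul_apply] at this
    rw [← this]
    rfl
  simp only [dualGen, map_sum, map_mul, polyInBasis, MvPolynomial.aeval_X, MvPolynomial.aeval_C,
    MvPolynomial.algebraMap_eq, Finset.mul_sum]
  rw [Finset.sum_comm]
  simp only [← mul_assoc, ← map_mul, ← Finset.sum_mul, ← map_sum, h2]
  simp

theorem polyInBasis_T (N : ℕ) : C.polyInBasis (C.T N) = C.toddPoly N := by
  have key : C.polyInBasis.comp (MvPolynomial.aeval C.dualGen) = AlgHom.id ℂ _ := by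
    apply MvPolynomial.algHom_ext
    intro i
    simp [polyInBasis_dualGen]
  exact DFunLike.congr_fun key (C.toddPoly N)

theorem inBasis_algebraMap (f : MvPolynomial (Fin n) ℂ) :
    C.inBasis (algebraMap _ (FractionRing (MvPolynomial (Fin n) ℂ)) f) =
      algebraMap _ (FractionRing (MvPolynomial (Fin n) ℂ)) (C.polyInBasis f) := by
  rw [inBasis, IsFractionRing.map, IsLocalization.map_eq]
  rfl

/-- In the coordinates of the basis B the dual vectors become the variables, so the denominator of
S^N becomes det M_C times the product of the variables. -/
theorem algebraMap_toddPoly_eq (N : ℕ) :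
    algebraMap (MvPolynomial (Fin n) ℂ) (FractionRing (MvPolynomial (Fin n) ℂ)) (C.toddPoly N) =
      algebraMap (MvPolynomial (Fin n) ℂ) (FractionRing (MvPolynomial (Fin n) ℂ))
        (MvPolynomial.C (C.M.det : ℂ) * ∏ i, MvPolynomial.X i) * C.inBasis (C.S N) := by
  have hC : C.polyInBasis (MvPolynomial.C (C.M.det : ℂ)) = MvPolynomial.C (C.M.det : ℂ) :=
    C.polyInBasis.commutes _
  have hne : algebraMap (MvPolynomial (Fin n) ℂ) (FractionRing (MvPolynomial (Fin n) ℂ))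
      (MvPolynomial.C (C.M.det : ℂ) * ∏ i, MvPolynomial.X i) ≠ 0 := by
    rw [map_ne_zero_iff _ (IsFractionRing.injective _ _)]
    refine mul_ne_zero ?_ (Finset.prod_ne_zero_iff.2 fun i _ => MvPolynomial.X_ne_zero i)
    rw [Ne, MvPolynomial.C_eq_zero]
    exact_mod_cast C.det_ne_zero
  rw [S, map_div₀, inBasis_algebraMap, inBasis_algebraMap, polyInBasis_T, map_mul C.polyInBasis,
    hC, map_prod C.polyInBasis]
  simp only [polyInBasis_dualGen]
  rw [mul_div_cancel₀ _ hne]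

end SimplicialCone

end Main

end ToddCone

end

theorem mainTheorem4 (m N q : ℕ) (p : Fin m → ℕ) (hq : 0 < q)
    (hp : ∀ i, 0 < p i ∧ p i < q ∧ Nat.Coprime (p i) q) :
    algebraMap (MvPolynomial (Fin (m + 1)) ℂ) (FractionRing (MvPolynomial (Fin (m + 1)) ℂ))
        ((ToddCone.dedekindCone q hq p).toddPoly N) =
      algebraMap (MvPolynomial (Fin (m + 1)) ℂ) (FractionRing (MvPolynomial (Fin (m + 1)) ℂ))
        (MvPolynomial.C (q : ℂ) * ∏ i, MvPolynomial.X i) *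
        (ToddCone.dedekindCone q hq p).inBasis ((ToddCone.dedekindCone q hq p).S N) ∧
    ∃ P : MvPolynomial (Fin (m + 1)) ℤ,
      (ToddCone.dedekindCone q hq p).toddPoly N =
        MvPolynomial.C (1 / (ToddCone.toddDenom N (m + 1) : ℂ)) *
          MvPolynomial.map (Int.castRingHom ℂ) P := by
  have hdet : (ToddCone.dedekindCone q hq p).M.det = (q : ℤ) := ToddCone.det_dedekindGen q p
  have h := (ToddCone.dedekindCone q hq p).algebraMap_toddPoly_eq N
  rw [hdet, Int.cast_natCast] at h
  exact ⟨h, ToddCone.exists_toddPoly_eq _ N⟩
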